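/- Let $P$ be a nonempty finite set of points in $\mathbb{R}^d$. For a nonempty finite set $C$ of centers write $cost(p,C)=\min_{c\in C}\|p-c\|^2$ and $cost(P,C)=\sum_{p\in P}cost(p,C)$, and let $OPT$ be the minimum of $cost(P,C^*)$ over all sets $C^*\subseteq\mathbb{R}^d$ of $k$ centers (at most $k$ centers, if $d=0$). To $D^2$-sample a point with respect to $C$ means to draw $p\in P$ with probability $cost(p,C)/cost(P,C)$ (and, say, uniformly if $cost(P,C)=0$). *$k$-means++ seeding*: choose $p\in P$ uniformly at random and set $C=\{p\}$; then repeat $k-1$ times: $D^2$-sample a point and add it to $C$. *One step of LocalSearch++*: $D^2$-sample $p\in P$ with respect to the current $C$; let $p'\in\arg\min_{q\in C}cost(P,(C\setminus\{q\})\cup\{p\})$, where ties are broken by an arbitrary fixed rule depending on $C$ and $p$; if $cost(P,(C\setminus\{p'\})\cup\{p\})<cost(P,C)$, replace $C$ by $(C\setminus\{p'\})\cup\{p\}$, and otherwise keep $C$. **Theorem.** There are absolute constants $K,c>0$ such that the following holds for every $d$, every such $P$, every $0<\varepsilon\le 1$, every integer $k\ge K/\varepsilon^{20}$ and every tie-breaking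 rule. Run $k$-means++ seeding and then $\ell=\varepsilon k$ steps of LocalSearch++ (with $\varepsilon k$ rounded down or up to an integer). Then, with probability at least $1-\exp(-c\,k^{0.1})$, the resulting set of centers $C$ satisfies $$cost(P,C)\le\frac{10^{30}}{\varepsilon^3}\cdot OPT .$$ -/

import Mathlib

noncomputable section

namespace KMeans

/-- `d`-dimensional Euclidean space. -/
abbrev Pt (d : ℕ) : Type := EuclideanSpace ℝ (Fin d)

variable {d : ℕ}

/-- `cost(p, C) = min_{c ∈ C} ‖p - c‖²`, the cost of a single point with respect to a (nonempty)
finite set of centers. -/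
def pointCost (p : Pt d) (C : Finset (Pt d)) : ℝ :=
  ⨅ c : {c : Pt d // c ∈ C}, ‖p - (c : Pt d)‖ ^ 2

/-- `cost(P, C) = ∑_{p ∈ P} min_{c ∈ C} ‖p - c‖²`. -/
def cost (P C : Finset (Pt d)) : ℝ :=
  ∑ p ∈ P, pointCost p C

/-- The optimal `k`-means cost, where centers are arbitrary points of `ℝ^d`. Allowing fewer than
`k` centers does not change the value, since adding centers never increases the cost; it only
avoids an empty infimum in the one-point space `ℝ^0`. -/
def optCost (P : Finset (Pt d)) (k : ℕ) : ℝ :=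
  sInf {x : ℝ | ∃ C : Finset (Pt d), C.Nonempty ∧ C.card ≤ k ∧ cost P C = x}

theorem pointCost_nonneg (p : Pt d) (C : Finset (Pt d)) : 0 ≤ pointCost p C :=
  Real.iInf_nonneg fun _ => sq_nonneg _

theorem sum_weights (P C : Finset (Pt d)) (h : 0 < cost P C) :
    ∑ p ∈ P, ENNReal.ofReal (pointCost p C / cost P C) = 1 := by
  rw [← ENNReal.ofReal_sum_of_nonneg fun p _ => div_nonneg (pointCost_nonneg p C) h.le,
    ← Finset.sum_div, ← cost, div_self h.ne', ENNReal.ofReal_one]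

open Classical in
/-- `D²`-sampling: the point `p ∈ P` is drawn with probability `cost(p, C) / cost(P, C)`.
If `cost(P, C) = 0` the quotient is undefined and `p ∈ P` is drawn uniformly. That convention is
immaterial: for nonempty `C` we then have `P ⊆ C`, so that adding a point of `P` to `C` does not
change `C`, and a local search step cannot decrease the cost. -/
def d2Sample (P : Finset (Pt d)) (hP : P.Nonempty) (C : Finset (Pt d)) : PMF (Pt d) :=
  if h : 0 < cost P C then
    PMF.ofFinset (fun p => if p ∈ P then ENNReal.ofReal (pointCost p C / cost P C) else 0) P
      (by rw [← sum_weights P C h]; exact Finset.sum_congr rfl fun p hp => if_pos hp)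
      (fun _ hp => if_neg hp)
  else PMF.uniformOfFinset P hP

open Classical in
/-- The distribution of the set of centers after the uniform first choice and `n` further rounds
of `D²`-sampling. -/
def seedingRounds (P : Finset (Pt d)) (hP : P.Nonempty) : ℕ → PMF (Finset (Pt d))
  | 0 => (PMF.uniformOfFinset P hP).map fun p => {p}
  | n + 1 => (seedingRounds P hP n).bind fun C => (d2Sample P hP C).map fun p => insert p C

/-- The distribution of the output of `k`-means++ seeding (`k ≥ 1`). -/
def seeding (P : Finset (Pt d)) (hP : P.Nonempty) (k : ℕ) : PMF (Finset (Pt d)) :=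
  seedingRounds P hP (k - 1)

open Classical in
/-- `(C \ {q}) ∪ {p}`. -/
def swap (C : Finset (Pt d)) (q p : Pt d) : Finset (Pt d) :=
  insert p (C.erase q)

/-- `pick C p` is a minimizer of `q ↦ cost(P, (C \ {q}) ∪ {p})` over `q ∈ C`, for all nonempty
`C ⊆ P` and all `p ∈ P`; ties are broken arbitrarily. -/
def IsArgminRule (P : Finset (Pt d)) (pick : Finset (Pt d) → Pt d → Pt d) : Prop :=
  ∀ C : Finset (Pt d), C ⊆ P → C.Nonempty → ∀ p ∈ P,
    pick C p ∈ C ∧ ∀ q ∈ C, cost P (swap C (pick C p) p) ≤ cost P (swap C q p)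

open Classical in
/-- One step of LocalSearch++ from the set of centers `C`: `D²`-sample a point `p`, and swap it
with the center `pick C p` if that strictly decreases the cost. -/
def localSearchStep (P : Finset (Pt d)) (hP : P.Nonempty) (pick : Finset (Pt d) → Pt d → Pt d)
    (C : Finset (Pt d)) : PMF (Finset (Pt d)) :=
  (d2Sample P hP C).map fun p =>
    if cost P (swap C (pick C p) p) < cost P C then swap C (pick C p) p else C

/-- The distribution of the set of centers after `k`-means++ seeding followed by the given number
of LocalSearch++ steps. -/
def seedingThenLocalSearch (P : Finset (Pt d)) (hP : P.Nonempty)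
    (pick : Finset (Pt d) → Pt d → Pt d) (k : ℕ) : ℕ → PMF (Finset (Pt d))
  | 0 => seeding P hP k
  | l + 1 => (seedingThenLocalSearch P hP pick k l).bind (localSearchStep P hP pick)

end KMeans

end

noncomputable section

namespace KMeans

open Classical
open scoped ENNReal

variable {d : ℕ}

/-! Compare `C` with a reference set `F` of at most `k` centers, chosen by
`exists_centers_cost_le_iff`. Match centers of `C` injectively to clusters of `F` for which they are
`T`-approximate centers; the deficit counts the unmatched ones. While the cost exceeds `T² cost P
F`, a `D²`-sample lands in an unserved cluster, at a point serving it, except with probability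
`20/T` (`sum_idle_le`). Only an exceptional sample can raise the deficit, and then by one. Deleting
a center never raises it, so the swaps of local search are harmless, whichever center they remove.
Hence `2 ^ deficit`, cut off once the cost is small, grows in expectation by at most `1 + 20/T` per
sample. After at most `2k` samples the deficit at scale `T = m` is therefore `O(k/m)`, with failure
probability exponentially small in `k/m`.

A deficit of at most `D` leaves at most `D` clusters unserved, and these carry nearly all the cost.
The capture argument for swaps then shows that a sample has probability at least `2/5` of reducing
the cost by the factor `1 - 1/(4D)` (`sum_not_improves_le`). At cost ratio `x`, the choice `m ≈
√x/2` gives a relative drop of order `√x/k`, so each success raises `k/√x` by a constant.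
Heuristically, `εk` steps thus bring `x` down to `O(1/ε²)`, which is within the claimed bound.

For concentration, scales are capped at some `M`; above ratio about `M²` the progress is measured by
`log x` instead. An exponential potential contracts by `4/5` per step outside bad states, and
`expect_chain_le` charges the bad states by a union bound over time. The starting ratio is
controlled by applying the deficit argument once more, with a huge `T` (`expect_cost_gt_le`). -/

/-! ### Point costs, nearest centers and clusters -/

theorem norm_sub_sq_le_two_mul (p q c : Pt d) : ‖p - q‖ ^ 2 ≤ 2 * ‖p - c‖ ^ 2 + 2 * ‖q - c‖ ^ 2 := by
  have h : ‖p - q‖ ≤ ‖p - c‖ + ‖q - c‖ := by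
    have := norm_sub_le (p - c) (q - c)
    simpa using this
  nlinarith [norm_nonneg (p - q), sq_nonneg (‖p - c‖ - ‖q - c‖)]

theorem pointCost_le (p : Pt d) {c : Pt d} {C : Finset (Pt d)} (hc : c ∈ C) :
    pointCost p C ≤ ‖p - c‖ ^ 2 :=
  ciInf_le (f := fun c : {c : Pt d // c ∈ C} => ‖p - (c : Pt d)‖ ^ 2)
    ⟨0, by rintro _ ⟨c, rfl⟩; positivity⟩ ⟨c, hc⟩

/-- A center of `C` closest to `p`. -/
def nearest (C : Finset (Pt d)) (p : Pt d) : Pt d :=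
  if h : C.Nonempty then (C.exists_min_image (fun c => ‖p - c‖ ^ 2) h).choose else p

theorem nearest_mem {C : Finset (Pt d)} (hC : C.Nonempty) (p : Pt d) : nearest C p ∈ C := by
  rw [nearest, dif_pos hC]
  exact (C.exists_min_image (fun c => ‖p - c‖ ^ 2) hC).choose_spec.1

theorem pointCost_eq {C : Finset (Pt d)} (hC : C.Nonempty) (p : Pt d) :
    pointCost p C = ‖p - nearest C p‖ ^ 2 := by
  apply le_antisymm (pointCost_le p (nearest_mem hC p))
  have : Nonempty {c : Pt d // c ∈ C} := hC.to_subtype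
  refine le_ciInf fun c => ?_
  rw [nearest, dif_pos hC]
  exact (C.exists_min_image (fun c => ‖p - c‖ ^ 2) hC).choose_spec.2 c c.2

theorem pointCost_anti (p : Pt d) {C C' : Finset (Pt d)} (hC : C.Nonempty) (h : C ⊆ C') :
    pointCost p C' ≤ pointCost p C := by
  rw [pointCost_eq hC]
  exact pointCost_le p (h (nearest_mem hC p))

theorem pointCost_of_mem {p : Pt d} {C : Finset (Pt d)} (h : p ∈ C) : pointCost p C = 0 :=
  le_antisymm (by simpa using pointCost_le p h) (pointCost_nonneg p C)

theorem pointCost_le_add (p c : Pt d) {C : Finset (Pt d)} (hC : C.Nonempty) :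
    pointCost p C ≤ 2 * ‖p - c‖ ^ 2 + 2 * pointCost c C := by
  rw [pointCost_eq hC c, norm_sub_rev c]
  exact (pointCost_le p (nearest_mem hC c)).trans (norm_sub_sq_le_two_mul _ _ _)

theorem cost_nonneg (P C : Finset (Pt d)) : 0 ≤ cost P C :=
  Finset.sum_nonneg fun p _ => pointCost_nonneg p C

theorem cost_anti (P : Finset (Pt d)) {C C' : Finset (Pt d)} (hC : C.Nonempty) (h : C ⊆ C') :
    cost P C' ≤ cost P C :=
  Finset.sum_le_sum fun p _ => pointCost_anti p hC h

/-- The points of `P` assigned to the center `c` of `F`. -/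
def cell (P F : Finset (Pt d)) (c : Pt d) : Finset (Pt d) :=
  P.filter fun p => nearest F p = c

theorem mem_cell {P F : Finset (Pt d)} {c p : Pt d} :
    p ∈ cell P F c ↔ p ∈ P ∧ nearest F p = c := by
  simp [cell]

theorem sum_cell (P : Finset (Pt d)) {F : Finset (Pt d)} (hF : F.Nonempty) (f : Pt d → ℝ) :
    ∑ c ∈ F, ∑ p ∈ cell P F c, f p = ∑ p ∈ P, f p :=
  Finset.sum_fiberwise_of_maps_to (fun p _ => nearest_mem hF p) f

theorem sum_cell_sq (P : Finset (Pt d)) {F : Finset (Pt d)} (hF : F.Nonempty) :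
    ∑ c ∈ F, ∑ p ∈ cell P F c, ‖p - c‖ ^ 2 = cost P F := by
  rw [cost, ← sum_cell P hF]
  refine Finset.sum_congr rfl fun c _ => Finset.sum_congr rfl fun p hp => ?_
  rw [pointCost_eq hF, (mem_cell.1 hp).2]

/-! ### Approximate centers and the mass of useless samples -/

/-- The center `q` serves the cluster of `c` if it is a `T`-approximate center for it. -/
def Serves (P F : Finset (Pt d)) (T : ℝ) (q c : Pt d) : Prop :=
  ∑ p ∈ cell P F c, ‖p - q‖ ^ 2 ≤ T * ∑ p ∈ cell P F c, ‖p - c‖ ^ 2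

/-- Markov's inequality: by the relaxed triangle inequality, a point that is a bad center for `A`
has squared distance to `c` more than `(T - 2) / 2` times the average. -/
theorem card_far_mul_le (A : Finset (Pt d)) (c : Pt d) (T : ℝ) :
    ((A.filter fun p => T * ∑ q ∈ A, ‖q - c‖ ^ 2 < ∑ q ∈ A, ‖q - p‖ ^ 2).card : ℝ) * (T - 2) ≤
      2 * A.card := by
  set V := ∑ q ∈ A, ‖q - c‖ ^ 2 with hV
  set N := A.filter fun p => T * V < ∑ q ∈ A, ‖q - p‖ ^ 2 with hN
  have hV0 : 0 ≤ V := Finset.sum_nonneg fun _ _ => by positivity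
  have hfar : ∀ p ∈ N, (T - 2) * V < 2 * A.card * ‖p - c‖ ^ 2 := by
    intro p hp
    have h1 := (Finset.mem_filter.1 hp).2
    have h2 : ∑ q ∈ A, ‖q - p‖ ^ 2 ≤ ∑ q ∈ A, (2 * ‖q - c‖ ^ 2 + 2 * ‖p - c‖ ^ 2) :=
      Finset.sum_le_sum fun q _ => norm_sub_sq_le_two_mul _ _ _
    rw [Finset.sum_add_distrib, ← Finset.mul_sum, ← hV, Finset.sum_const, nsmul_eq_mul] at h2
    linarith
  have hNA : ∑ p ∈ N, ‖p - c‖ ^ 2 ≤ V :=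
    Finset.sum_le_sum_of_subset_of_nonneg (Finset.filter_subset _ _) fun _ _ _ => by positivity
  rcases hV0.eq_or_lt with h0 | h0
  · have : N = ∅ := by
      refine Finset.eq_empty_of_forall_notMem fun p hp => ?_
      have h1 := hfar p hp
      have h2 : ‖p - c‖ ^ 2 ≤ V :=
        Finset.single_le_sum (f := fun q => ‖q - c‖ ^ 2) (fun _ _ => by positivity)
          (Finset.mem_filter.1 hp).1
      have h3 : ‖p - c‖ ^ 2 = 0 := le_antisymm (by linarith) (by positivity)
      rw [h3, ← h0] at h1
      simp at h1
    rw [this]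
    simp
  · have h1 : ∑ p ∈ N, (T - 2) * V ≤ ∑ p ∈ N, 2 * A.card * ‖p - c‖ ^ 2 :=
      Finset.sum_le_sum fun p hp => (hfar p hp).le
    rw [Finset.sum_const, nsmul_eq_mul, ← Finset.mul_sum] at h1
    have h2 : (2 * A.card : ℝ) * ∑ p ∈ N, ‖p - c‖ ^ 2 ≤ 2 * A.card * V := by gcongr
    refine le_of_mul_le_mul_right ?_ h0
    linarith

/-- Far points may be expensive because they are far from `c`, which costs at most the cluster's own
variance, or because `c` is far from `C`. In the second case all of `A` is expensive, and the far
points are only a small fraction of it. -/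
theorem sum_far_pointCost_le (A : Finset (Pt d)) (c : Pt d) {T : ℝ} (hT : 2 < T)
    {C : Finset (Pt d)} (hC : C.Nonempty) :
    ∑ p ∈ A.filter (fun p => T * ∑ q ∈ A, ‖q - c‖ ^ 2 < ∑ q ∈ A, ‖q - p‖ ^ 2), pointCost p C ≤
      2 * ∑ p ∈ A, ‖p - c‖ ^ 2 +
        8 / (T - 2) * (∑ p ∈ A, ‖p - c‖ ^ 2 + ∑ p ∈ A, pointCost p C) := by
  have hcard := card_far_mul_le A c T
  set V := ∑ q ∈ A, ‖q - c‖ ^ 2 with hV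
  set N := A.filter fun p => T * V < ∑ q ∈ A, ‖q - p‖ ^ 2 with hN
  have hT' : 0 < T - 2 := by linarith
  have hNA : ∑ p ∈ N, ‖p - c‖ ^ 2 ≤ V :=
    Finset.sum_le_sum_of_subset_of_nonneg (Finset.filter_subset _ _) fun _ _ _ => by positivity
  have h1 : ∑ p ∈ N, pointCost p C ≤ 2 * V + 2 * (N.card * pointCost c C) := by
    calc ∑ p ∈ N, pointCost p C ≤ ∑ p ∈ N, (2 * ‖p - c‖ ^ 2 + 2 * pointCost c C) :=
          Finset.sum_le_sum fun p _ => pointCost_le_add p c hC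
      _ = 2 * ∑ p ∈ N, ‖p - c‖ ^ 2 + N.card * (2 * pointCost c C) := by
          rw [Finset.sum_add_distrib, ← Finset.mul_sum, Finset.sum_const, nsmul_eq_mul]
      _ ≤ _ := by linarith
  have h2 : A.card * pointCost c C ≤ 2 * V + 2 * ∑ p ∈ A, pointCost p C := by
    calc A.card * pointCost c C = ∑ p ∈ A, pointCost c C := by
          rw [Finset.sum_const, nsmul_eq_mul]
      _ ≤ ∑ p ∈ A, (2 * ‖p - c‖ ^ 2 + 2 * pointCost p C) :=
          Finset.sum_le_sum fun p _ => by
            rw [norm_sub_rev]; exact pointCost_le_add c p hC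
      _ = _ := by rw [Finset.sum_add_distrib, ← Finset.mul_sum, ← Finset.mul_sum]
  have h3 : N.card * pointCost c C ≤ 2 / (T - 2) * (2 * V + 2 * ∑ p ∈ A, pointCost p C) := by
    calc N.card * pointCost c C ≤ (2 / (T - 2) * A.card) * pointCost c C := by
          refine mul_le_mul_of_nonneg_right ?_ (pointCost_nonneg _ _)
          rw [div_mul_eq_mul_div, le_div_iff₀ hT']
          exact hcard
      _ = 2 / (T - 2) * (A.card * pointCost c C) := by ring
      _ ≤ _ := by gcongr
  calc _ ≤ 2 * V + 2 * (N.card * pointCost c C) := h1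
    _ ≤ 2 * V + 2 * (2 / (T - 2) * (2 * V + 2 * ∑ p ∈ A, pointCost p C)) := by gcongr
    _ = _ := by ring

theorem sum_filter_cell (P : Finset (Pt d)) {F : Finset (Pt d)} (hF : F.Nonempty)
    (R : Pt d → Pt d → Prop) [∀ p c, Decidable (R p c)] (f : Pt d → ℝ) :
    ∑ p ∈ P.filter (fun p => R p (nearest F p)), f p =
      ∑ c ∈ F, ∑ p ∈ (cell P F c).filter (fun p => R p c), f p := by
  rw [Finset.sum_filter, ← sum_cell P hF]
  refine Finset.sum_congr rfl fun c _ => ?_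
  rw [Finset.sum_filter]
  refine Finset.sum_congr rfl fun p hp => ?_
  rw [(mem_cell.1 hp).2]

theorem sum_not_serves_le (P : Finset (Pt d)) {F : Finset (Pt d)} (hF : F.Nonempty) {T : ℝ}
    (hT : 2 < T) {C : Finset (Pt d)} (hC : C.Nonempty) :
    ∑ p ∈ P.filter (fun p => ¬ Serves P F T p (nearest F p)), pointCost p C ≤
      2 * cost P F + 8 / (T - 2) * (cost P F + cost P C) := by
  rw [sum_filter_cell P hF (fun p c => ¬ Serves P F T p c)]
  calc _ ≤ ∑ c ∈ F, (2 * ∑ p ∈ cell P F c, ‖p - c‖ ^ 2 +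
        8 / (T - 2) * (∑ p ∈ cell P F c, ‖p - c‖ ^ 2 + ∑ p ∈ cell P F c, pointCost p C)) := by
        refine Finset.sum_le_sum fun c _ => ?_
        simp only [Serves, not_le]
        exact sum_far_pointCost_le (cell P F c) c hT hC
    _ = _ := by
        rw [Finset.sum_add_distrib, ← Finset.mul_sum, ← Finset.mul_sum, Finset.sum_add_distrib,
          sum_cell_sq P hF, sum_cell P hF, cost, cost]

theorem card_not_serves_mul_le (P : Finset (Pt d)) {F : Finset (Pt d)} (hF : F.Nonempty) (T : ℝ) :
    ((P.filter (fun p => ¬ Serves P F T p (nearest F p))).card : ℝ) * (T - 2) ≤ 2 * P.card := by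
  have h := sum_filter_cell P hF (fun p c => ¬ Serves P F T p c) (fun _ => 1)
  have h' := sum_cell P hF (fun _ => 1)
  simp only [Finset.sum_const, nsmul_eq_mul, mul_one] at h h'
  rw [h, ← h', Finset.sum_mul, Finset.mul_sum]
  refine Finset.sum_le_sum fun c _ => ?_
  simp only [Serves, not_le]
  exact card_far_mul_le (cell P F c) c T

theorem sum_cell_le_of_serves {P F C : Finset (Pt d)} {T : ℝ} {q c : Pt d} (hq : q ∈ C)
    (h : Serves P F T q c) :
    ∑ p ∈ cell P F c, pointCost p C ≤ T * ∑ p ∈ cell P F c, ‖p - c‖ ^ 2 :=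
  (Finset.sum_le_sum fun p _ => pointCost_le p hq).trans h

theorem sum_served_le (P : Finset (Pt d)) {F : Finset (Pt d)} (hF : F.Nonempty) {T : ℝ}
    (hT : 0 ≤ T) (C : Finset (Pt d)) :
    ∑ c ∈ F.filter (fun c => ∃ q ∈ C, Serves P F T q c), ∑ p ∈ cell P F c, pointCost p C ≤
      T * cost P F := by
  rw [← sum_cell_sq P hF, Finset.mul_sum]
  calc _ ≤ ∑ c ∈ F.filter (fun c => ∃ q ∈ C, Serves P F T q c),
        T * ∑ p ∈ cell P F c, ‖p - c‖ ^ 2 :=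
        Finset.sum_le_sum fun c hc => by
          obtain ⟨q, hq, h⟩ := (Finset.mem_filter.1 hc).2
          exact sum_cell_le_of_serves hq h
    _ ≤ _ := Finset.sum_le_sum_of_subset_of_nonneg (Finset.filter_subset _ _) fun _ _ _ =>
        mul_nonneg hT (Finset.sum_nonneg fun _ _ => by positivity)

/-- Sampling `p` makes no progress if the cluster of `p` was served before or if `p` does not
serve it. -/
def Idle (P F : Finset (Pt d)) (T : ℝ) (C : Finset (Pt d)) (p : Pt d) : Prop :=
  (∃ q ∈ C, Serves P F T q (nearest F p)) ∨ ¬ Serves P F T p (nearest F p)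

/-- Served clusters cost at most `T * cost P F`, which is below `cost P C / T` by the assumed gap
`T²`. Badly placed points carry a fraction of about `8 / T`, up to multiples of `cost P F` that the
gap absorbs. -/
theorem sum_idle_le (P : Finset (Pt d)) {F : Finset (Pt d)} (hF : F.Nonempty) {T : ℝ}
    (hT : 20 ≤ T) {C : Finset (Pt d)} (hC : C.Nonempty) (h : T ^ 2 * cost P F < cost P C) :
    ∑ p ∈ P.filter (Idle P F T C), pointCost p C ≤ 20 / T * cost P C := by
  have h1 : ∑ p ∈ P.filter (fun p => ∃ q ∈ C, Serves P F T q (nearest F p)), pointCost p C ≤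
      T * cost P F := by
    refine le_trans (le_of_eq ?_) (sum_served_le P hF (by linarith) C)
    rw [sum_filter_cell P hF (fun p c => ∃ q ∈ C, Serves P F T q c), Finset.sum_filter]
    refine Finset.sum_congr rfl fun c _ => ?_
    split_ifs with hc <;> simp [hc]
  have h2 := sum_not_serves_le P hF (by linarith : 2 < T) hC
  have h3 : ∑ p ∈ P.filter (Idle P F T C), pointCost p C ≤
      ∑ p ∈ P.filter (fun p => ∃ q ∈ C, Serves P F T q (nearest F p)), pointCost p C +
      ∑ p ∈ P.filter (fun p => ¬ Serves P F T p (nearest F p)), pointCost p C := by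
    rw [← Finset.sum_union_inter]
    refine le_add_of_le_of_nonneg (Finset.sum_le_sum_of_subset_of_nonneg (fun p hp => ?_)
      fun p _ _ => pointCost_nonneg p C) (Finset.sum_nonneg fun p _ => pointCost_nonneg p C)
    obtain ⟨hp, hi⟩ := Finset.mem_filter.1 hp
    rw [Finset.mem_union, Finset.mem_filter, Finset.mem_filter]
    exact hi.imp (⟨hp, ·⟩) (⟨hp, ·⟩)
  have hT0 : 0 < T := by linarith
  have h4 : 8 / (T - 2) ≤ 9 / T := by
    rw [div_le_div_iff₀ (by linarith) hT0]; linarith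
  have hF0 := cost_nonneg P F
  have hC0 := cost_nonneg P C
  have h5 : 8 / (T - 2) * (cost P F + cost P C) ≤ 9 / T * (cost P F + cost P C) := by gcongr
  have h6 : ∀ x : ℝ, x / T * cost P C = x * (cost P C / T) := fun x => by ring
  have h7 : T * cost P F ≤ cost P C / T := by
    rw [le_div_iff₀ hT0]; nlinarith
  have h8 : 9 / T ≤ 1 := by rw [div_le_one hT0]; linarith
  have h9 : 9 / T * cost P F ≤ cost P F := by nlinarith
  have h10 : 20 * cost P F ≤ T * cost P F := by gcongr
  rw [h6]
  have h11 := h6 9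
  rw [mul_add] at h5
  linarith

/-! ### The matching deficit and its behaviour under insertion and deletion -/

/-- The number of centers of `C` left over by a largest matching of centers to clusters that they
serve. -/
def deficit (P F : Finset (Pt d)) (T : ℝ) (C : Finset (Pt d)) : ℕ :=
  sInf {n | ∃ L ⊆ C, ∃ f : Pt d → Pt d, Set.InjOn f L ∧ (∀ q ∈ L, f q ∈ F ∧ Serves P F T q (f q)) ∧
    C.card ≤ L.card + n}

theorem exists_matching (P F : Finset (Pt d)) (T : ℝ) (C : Finset (Pt d)) :
    ∃ L ⊆ C, ∃ f : Pt d → Pt d, Set.InjOn f L ∧ (∀ q ∈ L, f q ∈ F ∧ Serves P F T q (f q)) ∧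
      C.card ≤ L.card + deficit P F T C :=
  Nat.sInf_mem (s := {n | ∃ L ⊆ C, ∃ f : Pt d → Pt d, Set.InjOn f L ∧
    (∀ q ∈ L, f q ∈ F ∧ Serves P F T q (f q)) ∧ C.card ≤ L.card + n})
    ⟨C.card, ∅, by simp, id, by simp, by simp, by simp⟩

theorem deficit_le {P F : Finset (Pt d)} {T : ℝ} {C L : Finset (Pt d)} (hL : L ⊆ C)
    (f : Pt d → Pt d) (hf : Set.InjOn f L) (hs : ∀ q ∈ L, f q ∈ F ∧ Serves P F T q (f q)) {n : ℕ}
    (hn : C.card ≤ L.card + n) : deficit P F T C ≤ n :=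
  Nat.sInf_le ⟨L, hL, f, hf, hs, hn⟩

theorem deficit_le_card (P F : Finset (Pt d)) (T : ℝ) (C : Finset (Pt d)) :
    deficit P F T C ≤ C.card :=
  deficit_le (L := ∅) (by simp) id (by simp) (by simp) (by simp)

theorem deficit_insert_le (P F : Finset (Pt d)) (T : ℝ) (C : Finset (Pt d)) (p : Pt d) :
    deficit P F T (insert p C) ≤ deficit P F T C + 1 := by
  obtain ⟨L, hL, f, hf, hs, hn⟩ := exists_matching P F T C
  refine deficit_le (hL.trans (Finset.subset_insert _ _)) f hf hs ?_
  have := Finset.card_insert_le p C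
  omega

/-- No center of `C` serves the cluster of `p`, so that cluster is free in any matching and `p`
itself can be matched to it. -/
theorem deficit_insert_le_of_not_idle {P F : Finset (Pt d)} (hF : F.Nonempty) {T : ℝ}
    {C : Finset (Pt d)} {p : Pt d} (hp : ¬ Idle P F T C p) :
    deficit P F T (insert p C) ≤ deficit P F T C := by
  obtain ⟨L, hL, f, hf, hs, hn⟩ := exists_matching P F T C
  simp only [Idle, not_or, not_exists, not_and, not_not] at hp
  have hpL : p ∉ L := fun h => hp.1 p (hL h) hp.2
  have hfL : ∀ q ∈ L, f q ≠ nearest F p := fun q hq h => hp.1 q (hL hq) (h ▸ (hs q hq).2)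
  refine deficit_le (L := insert p L) (Finset.insert_subset_insert _ hL)
    (Function.update f p (nearest F p)) ?_ ?_ ?_
  · have hne : ∀ q ∈ L, q ≠ p := fun q hq h => hpL (h ▸ hq)
    intro a ha b hb hab
    simp only [Finset.coe_insert, Set.mem_insert_iff, Finset.mem_coe] at ha hb
    rcases ha with rfl | ha <;> rcases hb with rfl | hb
    · rfl
    · rw [Function.update_self, Function.update_of_ne (hne b hb)] at hab
      exact absurd hab.symm (hfL b hb)
    · rw [Function.update_self, Function.update_of_ne (hne a ha)] at hab
      exact absurd hab (hfL a ha)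
    · rw [Function.update_of_ne (hne a ha), Function.update_of_ne (hne b hb)] at hab
      exact hf ha hb hab
  · intro q hq
    rcases Finset.mem_insert.1 hq with rfl | hq
    · rw [Function.update_self]
      exact ⟨nearest_mem hF _, hp.2⟩
    · rw [Function.update_of_ne (ne_of_mem_of_not_mem hq hpL)]
      exact hs q hq
  · have := Finset.card_insert_le p C
    rw [Finset.card_insert_of_notMem hpL]
    omega

/-- The set of centers loses exactly one element and the matching at most one. -/
theorem deficit_erase_le (P F : Finset (Pt d)) (T : ℝ) {C : Finset (Pt d)} {q : Pt d}
    (hq : q ∈ C) : deficit P F T (C.erase q) ≤ deficit P F T C := by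
  obtain ⟨L, hL, f, hf, hs, hn⟩ := exists_matching P F T C
  refine deficit_le (L := L.erase q) (Finset.erase_subset_erase _ hL) f
    (hf.mono (by simp)) (fun a ha => hs a (Finset.mem_of_mem_erase ha)) ?_
  have h1 := Finset.card_erase_add_one hq
  have h2 := Finset.pred_card_le_card_erase (s := L) (a := q)
  omega

theorem Idle.mono {P F : Finset (Pt d)} {T : ℝ} {C C' : Finset (Pt d)} {p : Pt d} (h : C' ⊆ C)
    (hp : Idle P F T C' p) : Idle P F T C p :=
  hp.imp_left fun ⟨q, hq, h'⟩ => ⟨q, h hq, h'⟩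

theorem deficit_swap_le (P F : Finset (Pt d)) (T : ℝ) {C : Finset (Pt d)} {q : Pt d} (hq : q ∈ C)
    (p : Pt d) : deficit P F T (swap C q p) ≤ deficit P F T C + 1 :=
  (deficit_insert_le P F T _ p).trans (Nat.add_le_add_right (deficit_erase_le P F T hq) 1)

theorem deficit_swap_le_of_not_idle {P F : Finset (Pt d)} (hF : F.Nonempty) {T : ℝ}
    {C : Finset (Pt d)} {q : Pt d} (hq : q ∈ C) {p : Pt d} (hp : ¬ Idle P F T C p) :
    deficit P F T (swap C q p) ≤ deficit P F T C :=
  (deficit_insert_le_of_not_idle hF fun h => hp (h.mono (Finset.erase_subset _ _))).trans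
    (deficit_erase_le P F T hq)

/-- Matched centers serve distinct clusters, and at least `F.card - deficit` centers are matched. -/
theorem card_not_served_le (P : Finset (Pt d)) {F : Finset (Pt d)} (T : ℝ) {C : Finset (Pt d)}
    (h : F.card ≤ C.card) :
    (F.filter (fun c => ¬ ∃ q ∈ C, Serves P F T q c)).card ≤ deficit P F T C := by
  obtain ⟨L, hL, f, hf, hs, hn⟩ := exists_matching P F T C
  have h1 : (L.image f).card = L.card := Finset.card_image_of_injOn hf
  have h2 : L.image f ⊆ F.filter (fun c => ∃ q ∈ C, Serves P F T q c) := by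
    intro c hc
    obtain ⟨q, hq, rfl⟩ := Finset.mem_image.1 hc
    exact Finset.mem_filter.2 ⟨(hs q hq).1, q, hL hq, (hs q hq).2⟩
  have h3 := Finset.card_le_card h2
  have h4 := Finset.card_filter_add_card_filter_not (s := F)
    (fun c => ∃ q ∈ C, Serves P F T q c)
  omega

theorem cost_le_of_deficit_eq_zero (P : Finset (Pt d)) {F : Finset (Pt d)} (hF : F.Nonempty)
    {T : ℝ} (hT : 0 ≤ T) {C : Finset (Pt d)} (h : F.card ≤ C.card) (h0 : deficit P F T C = 0) :
    cost P C ≤ T * cost P F := by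
  have h1 := card_not_served_le P T h
  rw [h0, Nat.le_zero, Finset.card_eq_zero, Finset.filter_eq_empty_iff] at h1
  have h2 := sum_served_le P hF hT C
  rwa [Finset.filter_true_of_mem fun c hc => not_not.1 (h1 hc), sum_cell P hF] at h2

/-! ### Improving swaps -/

/-- Routing `x` through its reference center `c` gives distance at most `2a + b`, where `a = ‖x -
c‖` and `b` is the distance from `x` to `C`. The cross term satisfies `4ab ≤ 80a² + b²/20`; the
small share of `b²` keeps the total reassignment cost a small fraction of `cost P C`. -/
theorem norm_sub_nearest_nearest_sq_le {F C : Finset (Pt d)} (hF : F.Nonempty) (hC : C.Nonempty)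
    (x : Pt d) : ‖x - nearest C (nearest F x)‖ ^ 2 ≤
      pointCost x C + (84 * pointCost x F + pointCost x C / 20) := by
  rw [pointCost_eq hC x, pointCost_eq hF x]
  set c := nearest F x
  set s := nearest C c
  set q := nearest C x
  have h1 : ‖c - s‖ ≤ ‖c - q‖ := by
    have := pointCost_le c (nearest_mem hC x)
    rw [pointCost_eq hC c] at this
    exact (pow_le_pow_iff_left₀ (norm_nonneg _) (norm_nonneg _) two_ne_zero).1 this
  have h2 : ‖c - q‖ ≤ ‖x - c‖ + ‖x - q‖ := by
    rw [norm_sub_rev x c]; simpa using norm_add_le (c - x) (x - q)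
  have h3 : ‖x - s‖ ≤ ‖x - c‖ + ‖c - s‖ := by simpa using norm_add_le (x - c) (c - s)
  have h4 : ‖x - s‖ ≤ 2 * ‖x - c‖ + ‖x - q‖ := by linarith
  have h5 := pow_le_pow_left₀ (norm_nonneg _) h4 2
  nlinarith [sq_nonneg (40 * ‖x - c‖ - ‖x - q‖)]

/-- An upper bound for the cost of reassigning the points of the cluster of `q` in `C`. -/
def reassignCost (P F C : Finset (Pt d)) (q : Pt d) : ℝ :=
  ∑ x ∈ cell P C q, (84 * pointCost x F + pointCost x C / 20)

theorem reassignCost_nonneg (P F C : Finset (Pt d)) (q : Pt d) : 0 ≤ reassignCost P F C q :=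
  Finset.sum_nonneg fun x _ => by
    have := pointCost_nonneg x F
    have := pointCost_nonneg x C
    positivity

theorem sum_reassignCost (P F : Finset (Pt d)) {C : Finset (Pt d)} (hC : C.Nonempty) :
    ∑ q ∈ C, reassignCost P F C q = 84 * cost P F + cost P C / 20 := by
  simp only [reassignCost]
  rw [sum_cell P hC, Finset.sum_add_distrib, ← Finset.mul_sum, ← Finset.sum_div, cost, cost]

/-- The new center `p` takes over the cluster of `h`. Any other point that loses `q` moves to the
center of `C` nearest to its reference center, which survives because `q` captures no reference
center except possibly `h`. -/
theorem cost_swap_le (P : Finset (Pt d)) {F C : Finset (Pt d)} (hF : F.Nonempty) {q h : Pt d}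
    (hq : q ∈ C) (hcap : ∀ c ∈ F, c ≠ h → nearest C c ≠ q) (p : Pt d) :
    cost P (swap C q p) ≤ cost P C - ∑ x ∈ cell P F h, pointCost x C + reassignCost P F C q +
      ∑ x ∈ cell P F h, ‖x - p‖ ^ 2 := by
  have hC : C.Nonempty := ⟨q, hq⟩
  have key : ∀ x ∈ P, pointCost x (swap C q p) ≤ pointCost x C -
      (if nearest F x = h then pointCost x C else 0) +
      (if nearest C x = q then 84 * pointCost x F + pointCost x C / 20 else 0) +
      (if nearest F x = h then ‖x - p‖ ^ 2 else 0) := by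
    intro x _
    have h1 := pointCost_nonneg x F
    have h2 := pointCost_nonneg x C
    have he : 0 ≤ (if nearest C x = q then 84 * pointCost x F + pointCost x C / 20 else 0) := by
      split_ifs <;> positivity
    by_cases hx : nearest F x = h
    · have := pointCost_le x (Finset.mem_insert_self p (C.erase q))
      rw [if_pos hx, if_pos hx]
      rw [swap]
      linarith
    · rw [if_neg hx, if_neg hx]
      by_cases hxq : nearest C x = q
      · rw [if_pos hxq]
        have hmem : nearest C (nearest F x) ∈ swap C q p :=
          Finset.mem_insert_of_mem (Finset.mem_erase.2
            ⟨hcap _ (nearest_mem hF x) hx, nearest_mem hC _⟩)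
        have := pointCost_le x hmem
        have := norm_sub_nearest_nearest_sq_le hF hC x
        linarith
      · have hmem : nearest C x ∈ swap C q p :=
          Finset.mem_insert_of_mem (Finset.mem_erase.2 ⟨hxq, nearest_mem hC _⟩)
        have := pointCost_le x hmem
        rw [← pointCost_eq hC x] at this
        linarith
  have := Finset.sum_le_sum key
  rw [Finset.sum_add_distrib, Finset.sum_add_distrib, Finset.sum_sub_distrib,
    ← Finset.sum_filter, ← Finset.sum_filter, ← Finset.sum_filter] at this
  exact this

/-- A center capturing a shared reference center captures at least two of them, so the image of `F`
under `nearest C` has at most `H₁.card + H₂.card / 2` elements. Since `C` is at least as large as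
`F`, at least `H₂.card / 2` centers capture nothing. -/
theorem card_shared_le {F C : Finset (Pt d)} (hC : C.Nonempty) (hFC : F.card ≤ C.card) :
    (F.filter fun h => ¬ ∀ c ∈ F, c ≠ h → nearest C c ≠ nearest C h).card ≤
      2 * (C.filter fun q => ∀ c ∈ F, nearest C c ≠ q).card := by
  set H₁ := F.filter fun h => ∀ c ∈ F, c ≠ h → nearest C c ≠ nearest C h with hH₁
  set H₂ := F.filter fun h => ¬ ∀ c ∈ F, c ≠ h → nearest C c ≠ nearest C h with hH₂
  have h1 : H₁.card + H₂.card = F.card := Finset.card_filter_add_card_filter_not _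
  have h2 : (C.filter fun q => ∀ c ∈ F, nearest C c ≠ q) = C \ F.image (nearest C) := by
    ext q; simp
  have h3 : F.image (nearest C) ⊆ C := by
    intro q hq
    obtain ⟨c, _, rfl⟩ := Finset.mem_image.1 hq
    exact nearest_mem hC c
  have h4 := Finset.card_sdiff_add_card_eq_card h3
  have h5 : F.image (nearest C) ⊆ H₁.image (nearest C) ∪ H₂.image (nearest C) := by
    rw [← Finset.image_union, Finset.filter_union_filter_not_eq]
  have h6 := (Finset.card_le_card h5).trans (Finset.card_union_le _ _)
  have h7 : (H₁.image (nearest C)).card ≤ H₁.card := Finset.card_image_le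
  have h8 : 2 * (H₂.image (nearest C)).card ≤ H₂.card := by
    refine Finset.mul_card_image_le_card _ _ fun a ha => ?_
    obtain ⟨h, hh, rfl⟩ := Finset.mem_image.1 ha
    obtain ⟨hhF, hc⟩ := Finset.mem_filter.1 hh
    push Not at hc
    obtain ⟨c, hcF, hch, hcc⟩ := hc
    refine Finset.one_lt_card.2 ⟨c, ?_, h, ?_, hch⟩
    · refine Finset.mem_filter.2 ⟨Finset.mem_filter.2 ⟨hcF, fun H => ?_⟩, hcc⟩
      exact H h hhF hch.symm hcc.symm
    · exact Finset.mem_filter.2 ⟨hh, rfl⟩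
  rw [h2]
  omega

/-- If `h` is captured alone, remove its captor; otherwise remove the cheapest center that captures
nothing. Captors are charged once in total, and the cheapest idle center at most twice the number of
idle centers, so the total charge is three times the full reassignment cost. -/
theorem exists_swap_cost_le (P : Finset (Pt d)) {F C : Finset (Pt d)} (hF : F.Nonempty)
    (hC : C.Nonempty) (hFC : F.card ≤ C.card) :
    ∃ R : Pt d → ℝ, (∀ h, 0 ≤ R h) ∧ ∑ h ∈ F, R h ≤ 252 * cost P F + 3 / 20 * cost P C ∧
      ∀ h ∈ F, ∃ q ∈ C, ∀ p, cost P (swap C q p) ≤ cost P C - ∑ x ∈ cell P F h, pointCost x C +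
        R h + ∑ x ∈ cell P F h, ‖x - p‖ ^ 2 := by
  set E := reassignCost P F C with hE
  have hE0 : ∀ q, 0 ≤ E q := reassignCost_nonneg P F C
  have hcard := card_shared_le hC hFC
  set Q : Pt d → Prop := fun h => ∀ c ∈ F, c ≠ h → nearest C c ≠ nearest C h with hQ
  set L := C.filter fun q => ∀ c ∈ F, nearest C c ≠ q with hL
  obtain ⟨q₀, hq₀⟩ : ∃ q₀, L.Nonempty → q₀ ∈ L ∧ ∀ q ∈ L, E q₀ ≤ E q := by
    by_cases h : L.Nonempty
    · obtain ⟨q₀, h1, h2⟩ := L.exists_min_image E h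
      exact ⟨q₀, fun _ => ⟨h1, h2⟩⟩
    · exact ⟨0, fun h' => absurd h' h⟩
  refine ⟨fun h => if Q h then E (nearest C h) else E q₀, fun h => ?_, ?_, fun h hh => ?_⟩
  · dsimp only
    split_ifs <;> exact hE0 _
  · rw [Finset.sum_ite, Finset.sum_const, nsmul_eq_mul]
    have h1 : ∑ h ∈ F.filter Q, E (nearest C h) ≤ ∑ q ∈ C, E q := by
      rw [← Finset.sum_image (f := E) (g := nearest C) (s := F.filter Q)]
      · refine Finset.sum_le_sum_of_subset_of_nonneg (fun q hq => ?_) fun q _ _ => hE0 q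
        obtain ⟨c, _, rfl⟩ := Finset.mem_image.1 hq
        exact nearest_mem hC c
      · intro a ha b hb hab
        by_contra hne
        exact (Finset.mem_filter.1 hb).2 a (Finset.mem_filter.1 ha).1 hne hab
    have h2 : L.card * E q₀ ≤ ∑ q ∈ C, E q := by
      calc L.card * E q₀ = ∑ q ∈ L, E q₀ := by rw [Finset.sum_const, nsmul_eq_mul]
        _ ≤ ∑ q ∈ L, E q := Finset.sum_le_sum fun q hq => (hq₀ ⟨q, hq⟩).2 q hq
        _ ≤ _ := Finset.sum_le_sum_of_subset_of_nonneg (Finset.filter_subset _ _)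
          fun q _ _ => hE0 q
    have h3 : ((F.filter fun h => ¬ Q h).card : ℝ) ≤ 2 * L.card := by exact_mod_cast hcard
    have h4 : ((F.filter fun h => ¬ Q h).card : ℝ) * E q₀ ≤ 2 * L.card * E q₀ :=
      mul_le_mul_of_nonneg_right h3 (hE0 _)
    have h5 := sum_reassignCost P F hC
    rw [← hE] at h5
    linarith
  · by_cases hQh : Q h
    · simp only [if_pos hQh]
      exact ⟨nearest C h, nearest_mem hC h, cost_swap_le P hF (nearest_mem hC h) hQh⟩
    · simp only [if_neg hQh]
      have hne : L.Nonempty := by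
        rw [← Finset.card_pos]
        have : 0 < (F.filter fun h => ¬ Q h).card :=
          Finset.card_pos.2 ⟨h, Finset.mem_filter.2 ⟨hh, hQh⟩⟩
        have := this.trans_le hcard
        omega
      obtain ⟨h1, h2⟩ := Finset.mem_filter.1 (hq₀ hne).1
      exact ⟨q₀, h1, cost_swap_le P hF h1 fun c hc _ => h2 c hc⟩

/-- The point `p` can be swapped in so that the cost drops to a fraction `r`. -/
def Improves (P C : Finset (Pt d)) (r : ℝ) (p : Pt d) : Prop :=
  ∃ q ∈ C, cost P (swap C q p) ≤ r * cost P C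

/-- The scale `T` serves only to bound the number of unserved clusters by `D`. The sampled point
need only be a `100`-approximate center, a fixed quality that most of the sampling mass has. -/
theorem sum_not_improves_le (P : Finset (Pt d)) {F C : Finset (Pt d)} (hF : F.Nonempty)
    (hC : C.Nonempty) (hFC : F.card ≤ C.card) {T : ℝ} (hT : 1000 ≤ T)
    (h : T ^ 2 * cost P F < cost P C) {D : ℝ} (hD : deficit P F T C ≤ D) :
    ∑ p ∈ P.filter (fun p => ¬ Improves P C (1 - 1 / (4 * D)) p), pointCost p C ≤
      3 / 5 * cost P C := by
  obtain ⟨R, hR0, hR, hswap⟩ := exists_swap_cost_le P hF hC hFC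
  have hF0 := cost_nonneg P F
  have hC0 := cost_nonneg P C
  have hT1 : 1000 * (T * cost P F) ≤ cost P C := by
    have : 0 ≤ T * cost P F := by positivity
    nlinarith
  have hT2 : 1000 * cost P F ≤ T * cost P F := by gcongr
  set S : Pt d → ℝ := fun c => ∑ x ∈ cell P F c, pointCost x C with hS
  set V : Pt d → ℝ := fun c => ∑ x ∈ cell P F c, ‖x - c‖ ^ 2 with hV
  have hS0 : ∀ c, 0 ≤ S c := fun c => Finset.sum_nonneg fun x _ => pointCost_nonneg x C
  have hV0 : ∀ c, 0 ≤ V c := fun c => Finset.sum_nonneg fun x _ => by positivity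
  have hSF : ∑ c ∈ F, S c = cost P C := sum_cell P hF _
  have hVF : ∑ c ∈ F, V c = cost P F := sum_cell_sq P hF
  set W := F.filter fun c => ∃ q ∈ C, Serves P F T q c with hW
  set U := F.filter fun c => ¬ ∃ q ∈ C, Serves P F T q c with hU
  have hUF : U ⊆ F := Finset.filter_subset _ _
  have hUD : (U.card : ℝ) ≤ D := le_trans (by exact_mod_cast card_not_served_le P T hFC) hD
  have hD0 : 0 ≤ D := le_trans (Nat.cast_nonneg _) hUD
  have hWs : ∑ c ∈ W, S c ≤ T * cost P F := sum_served_le P hF (by linarith) C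
  have hWU : ∑ c ∈ W, S c + ∑ c ∈ U, S c = cost P C := by
    rw [← hSF]; exact Finset.sum_filter_add_sum_filter_not _ _ _
  have hUR : ∑ c ∈ U, R c ≤ ∑ c ∈ F, R c :=
    Finset.sum_le_sum_of_subset_of_nonneg hUF fun c _ _ => hR0 c
  have hUV : ∑ c ∈ U, V c ≤ cost P F := by
    rw [← hVF]; exact Finset.sum_le_sum_of_subset_of_nonneg hUF fun c _ _ => hV0 c
  -- `g c` bounds from below the gain from swapping in a `100`-approximate center of the cluster of
  -- `c`. At most `D` clusters are unserved, so those gaining less than `cost P C / (4 * D)` account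
  -- for at most a quarter of the cost.
  set g : Pt d → ℝ := fun c => S c - R c - 100 * V c with hg
  set G := U.filter fun c => cost P C / (4 * D) ≤ g c with hG
  have hsum : ∑ c ∈ U, g c = ∑ c ∈ U, S c - ∑ c ∈ U, R c - 100 * ∑ c ∈ U, V c := by
    simp only [hg]
    rw [Finset.sum_sub_distrib, Finset.sum_sub_distrib, ← Finset.mul_sum]
  have hsplit : ∑ c ∈ G, g c + ∑ c ∈ U.filter (fun c => ¬ cost P C / (4 * D) ≤ g c), g c =
      ∑ c ∈ U, g c := Finset.sum_filter_add_sum_filter_not _ _ _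
  have hpoor : ∑ c ∈ U.filter (fun c => ¬ cost P C / (4 * D) ≤ g c), g c ≤ cost P C / 4 := by
    have hq : 0 ≤ cost P C / (4 * D) := by positivity
    calc _ ≤ ∑ c ∈ U.filter (fun c => ¬ cost P C / (4 * D) ≤ g c), cost P C / (4 * D) :=
          Finset.sum_le_sum fun c hc => (not_le.1 (Finset.mem_filter.1 hc).2).le
      _ ≤ ∑ c ∈ U, cost P C / (4 * D) :=
          Finset.sum_le_sum_of_subset_of_nonneg (Finset.filter_subset _ _) fun _ _ _ => hq
      _ = U.card * (cost P C / (4 * D)) := by rw [Finset.sum_const, nsmul_eq_mul]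
      _ ≤ D * (cost P C / (4 * D)) := by gcongr
      _ = cost P C / 4 * (D / D) := by ring
      -- An inequality rather than `D / D = 1`, so that `D = 0` is covered.
      _ ≤ cost P C / 4 * 1 := by gcongr; exact div_self_le_one D
      _ = _ := mul_one _
  have hGS : ∑ c ∈ G, g c ≤ ∑ c ∈ G, S c :=
    Finset.sum_le_sum fun c _ => by have := hR0 c; have := hV0 c; simp only [hg]; linarith
  have hGF : G ⊆ F := (Finset.filter_subset _ _).trans hUF
  have hFG : ∑ c ∈ F \ G, S c + ∑ c ∈ G, S c = cost P C := by
    rw [Finset.sum_sdiff hGF, hSF]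
  have himp : ∀ p, nearest F p ∈ G → Serves P F 100 p (nearest F p) →
      Improves P C (1 - 1 / (4 * D)) p := by
    intro p hp hs
    obtain ⟨q, hq, hle⟩ := hswap _ (hGF hp)
    refine ⟨q, hq, (hle p).trans ?_⟩
    have h1 := (Finset.mem_filter.1 hp).2
    have h2 : (1 - 1 / (4 * D)) * cost P C = cost P C - cost P C / (4 * D) := by ring
    have h3 : ∑ x ∈ cell P F (nearest F p), ‖x - p‖ ^ 2 ≤ 100 * V (nearest F p) := hs
    rw [h2]
    simp only [hg, hS] at h1
    linarith
  have hns := sum_not_serves_le P hF (by norm_num : (2 : ℝ) < 100) hC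
  have hFGsum : ∑ p ∈ P.filter (fun p => nearest F p ∉ G), pointCost p C = ∑ c ∈ F \ G, S c := by
    rw [sum_filter_cell P hF (fun _ c => c ∉ G), ← Finset.filter_notMem_eq_sdiff,
      Finset.sum_filter]
    refine Finset.sum_congr rfl fun c _ => ?_
    split_ifs with hc <;> simp [hc, hS]
  have hfin : ∑ p ∈ P.filter (fun p => ¬ Improves P C (1 - 1 / (4 * D)) p), pointCost p C ≤
      ∑ p ∈ P.filter (fun p => nearest F p ∉ G), pointCost p C +
      ∑ p ∈ P.filter (fun p => ¬ Serves P F 100 p (nearest F p)), pointCost p C := by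
    rw [← Finset.sum_union_inter]
    refine le_add_of_le_of_nonneg (Finset.sum_le_sum_of_subset_of_nonneg (fun p hp => ?_)
      fun p _ _ => pointCost_nonneg p C) (Finset.sum_nonneg fun p _ => pointCost_nonneg p C)
    obtain ⟨hp, hi⟩ := Finset.mem_filter.1 hp
    by_cases hpG : nearest F p ∈ G
    · by_cases hs : Serves P F 100 p (nearest F p)
      · exact absurd (himp p hpG hs) hi
      · exact Finset.mem_union_right _ (Finset.mem_filter.2 ⟨hp, hs⟩)
    · exact Finset.mem_union_left _ (Finset.mem_filter.2 ⟨hp, hpG⟩)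
  norm_num at hns
  linarith

/-! ### Expectations over probability mass functions and contracting chains -/

section Expectation

variable {α β : Type*}

/-- The expectation of a nonnegative function. -/
def expect (μ : PMF α) (f : α → ℝ≥0∞) : ℝ≥0∞ := ∑' a, μ a * f a

theorem expect_mono {μ : PMF α} {f g : α → ℝ≥0∞} (h : ∀ a ∈ μ.support, f a ≤ g a) :
    expect μ f ≤ expect μ g := by
  refine ENNReal.tsum_le_tsum fun a => ?_
  by_cases ha : a ∈ μ.support
  · gcongr
    exact h a ha
  · rw [(μ.apply_eq_zero_iff a).2 ha, zero_mul, zero_mul]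

theorem expect_const (μ : PMF α) (c : ℝ≥0∞) : expect μ (fun _ => c) = c := by
  rw [expect, ENNReal.tsum_mul_right, μ.tsum_coe, one_mul]

theorem expect_le_of_forall {μ : PMF α} {f : α → ℝ≥0∞} {c : ℝ≥0∞}
    (h : ∀ a ∈ μ.support, f a ≤ c) : expect μ f ≤ c :=
  (expect_mono h).trans (expect_const μ c).le

theorem expect_add (μ : PMF α) (f g : α → ℝ≥0∞) :
    expect μ (fun a => f a + g a) = expect μ f + expect μ g := by
  simp only [expect, mul_add]
  exact ENNReal.tsum_add

theorem expect_const_mul (μ : PMF α) (c : ℝ≥0∞) (f : α → ℝ≥0∞) :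
    expect μ (fun a => c * f a) = c * expect μ f := by
  rw [expect, expect, ← ENNReal.tsum_mul_left]
  exact tsum_congr fun a => by ring

theorem expect_sum {ι : Type*} (μ : PMF α) (s : Finset ι) (f : ι → α → ℝ≥0∞) :
    expect μ (fun a => ∑ i ∈ s, f i a) = ∑ i ∈ s, expect μ (f i) := by
  induction s using Finset.induction_on with
  | empty => simp [expect]
  | insert i s hi ih => simp only [Finset.sum_insert hi, expect_add, ih]

theorem expect_bind (μ : PMF α) (κ : α → PMF β) (f : β → ℝ≥0∞) :
    expect (μ.bind κ) f = expect μ fun a => expect (κ a) f := by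
  simp only [expect, PMF.bind_apply]
  simp_rw [← ENNReal.tsum_mul_right, ← ENNReal.tsum_mul_left]
  rw [ENNReal.tsum_comm]
  exact tsum_congr fun a => tsum_congr fun b => by ring

theorem expect_pure (a : α) (f : α → ℝ≥0∞) : expect (PMF.pure a) f = f a := by
  rw [expect, tsum_eq_single a]
  · simp
  · intro b hb
    simp [hb]

theorem expect_map (μ : PMF α) (g : α → β) (f : β → ℝ≥0∞) :
    expect (μ.map g) f = expect μ fun a => f (g a) := by
  rw [PMF.map, expect_bind]
  simp only [Function.comp, expect_pure]

theorem toOuterMeasure_eq_expect (μ : PMF α) (s : Set α) :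
    μ.toOuterMeasure s = expect μ fun a => if a ∈ s then 1 else 0 := by
  rw [PMF.toOuterMeasure_apply, expect]
  refine tsum_congr fun a => ?_
  by_cases h : a ∈ s <;> simp [h]

theorem toOuterMeasure_add_compl (μ : PMF α) (s : Set α) :
    μ.toOuterMeasure s + (expect μ fun a => if a ∈ s then 0 else 1) = 1 := by
  rw [toOuterMeasure_eq_expect, ← expect_add]
  refine Eq.trans ?_ (expect_const μ 1)
  congr 1
  ext a
  split_ifs <;> simp

theorem expect_chain_eq {κ : α → PMF α} {ν : ℕ → PMF α} (hν : ∀ t, ν (t + 1) = (ν t).bind κ)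
    (t : ℕ) (f : α → ℝ≥0∞) :
    expect (ν t) f = expect (ν 0) ((fun (f : α → ℝ≥0∞) a => expect (κ a) f)^[t] f) := by
  induction t generalizing f with
  | zero => rfl
  | succ t ih => rw [hν, expect_bind, ih, Function.iterate_succ_apply]

/-- If `V` contracts in expectation wherever `g < 1`, then, up to the expectations of `g`,
the probability dominated by `V` decays geometrically. -/
theorem expect_chain_le {κ : α → PMF α} {ν : ℕ → PMF α} (hν : ∀ t, ν (t + 1) = (ν t).bind κ)
    {I : α → Prop} (hI : ∀ a, I a → ∀ b ∈ (κ a).support, I b) (hI0 : ∀ a ∈ (ν 0).support, I a)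
    {f V g : α → ℝ≥0∞} {c r : ℝ≥0∞} (hf : ∀ a, I a → f a ≤ c * V a) (hf1 : ∀ a, f a ≤ 1)
    (hV : ∀ a, I a → g a < 1 → expect (κ a) V ≤ r * V a) (l : ℕ) :
    expect (ν l) f ≤ c * r ^ l * expect (ν 0) V + ∑ t ∈ Finset.range l, expect (ν t) g := by
  set Q : (α → ℝ≥0∞) → α → ℝ≥0∞ := fun f a => expect (κ a) f with hQ
  have hu1 : ∀ l a, Q^[l] f a ≤ 1 := by
    intro l
    induction l with
    | zero => exact hf1
    | succ l ih =>
      intro a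
      rw [Function.iterate_succ_apply']
      exact expect_le_of_forall fun b _ => ih b
  -- An induction on the number of remaining steps, from a fixed current state, replaces a
  -- stopping-time argument: in a bad state `1 ≤ g a`, and the summand `t = 0` already dominates any
  -- probability.
  have key : ∀ l a, I a → Q^[l] f a ≤ c * r ^ l * V a + ∑ t ∈ Finset.range l, Q^[t] g a := by
    intro l
    induction l with
    | zero => intro a ha; simpa using hf a ha
    | succ l ih =>
      intro a ha
      rw [Finset.sum_range_succ']
      rcases lt_or_ge (g a) 1 with hg | hg
      · rw [Function.iterate_succ_apply']
        calc Q (Q^[l] f) a ≤ expect (κ a) (fun b => c * r ^ l * V b +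
              ∑ t ∈ Finset.range l, Q^[t] g b) := expect_mono fun b hb => ih b (hI a ha b hb)
          _ = c * r ^ l * expect (κ a) V + ∑ t ∈ Finset.range l, Q^[t + 1] g a := by
            rw [expect_add, expect_const_mul, expect_sum]
            simp only [Function.iterate_succ_apply']
            rfl
          _ ≤ c * r ^ l * (r * V a) + ∑ t ∈ Finset.range l, Q^[t + 1] g a := by
            gcongr
            exact hV a ha hg
          _ = c * r ^ (l + 1) * V a + ∑ t ∈ Finset.range l, Q^[t + 1] g a := by
            rw [pow_succ]; ring
          _ ≤ _ := by rw [← add_assoc]; exact le_self_add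
      · exact (hu1 _ a).trans (hg.trans (le_add_left le_add_self))
  rw [expect_chain_eq hν]
  refine (expect_mono fun a ha => key l a (hI0 a ha)).trans (le_of_eq ?_)
  rw [expect_add, expect_const_mul, expect_sum]
  simp only [expect_chain_eq hν _ g]
  rfl

end Expectation

/-! ### Sampling estimates and reachable sets of centers -/

theorem expect_d2Sample {P : Finset (Pt d)} (hP : P.Nonempty) {C : Finset (Pt d)}
    (h : 0 < cost P C) (f : Pt d → ℝ≥0∞) :
    expect (d2Sample P hP C) f = ∑ p ∈ P, ENNReal.ofReal (pointCost p C / cost P C) * f p := by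
  rw [expect, tsum_eq_sum (s := P)]
  · refine Finset.sum_congr rfl fun p hp => ?_
    rw [d2Sample, dif_pos h, PMF.ofFinset_apply, if_pos hp]
  · intro p hp
    rw [d2Sample, dif_pos h, PMF.ofFinset_apply, if_neg hp, zero_mul]

theorem expect_d2Sample_le {P : Finset (Pt d)} (hP : P.Nonempty) {C : Finset (Pt d)}
    (h : 0 < cost P C) {Q : Pt d → Prop} [DecidablePred Q] {δ : ℝ}
    (hδ : ∑ p ∈ P.filter Q, pointCost p C ≤ δ * cost P C) {f : Pt d → ℝ≥0∞} {a b : ℝ≥0∞}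
    (hf : ∀ p ∈ P, f p ≤ a + if Q p then b else 0) :
    expect (d2Sample P hP C) f ≤ a + b * ENNReal.ofReal δ := by
  rw [expect_d2Sample hP h]
  have hw : ∑ p ∈ P.filter Q, ENNReal.ofReal (pointCost p C / cost P C) ≤ ENNReal.ofReal δ := by
    rw [← ENNReal.ofReal_sum_of_nonneg fun p _ => div_nonneg (pointCost_nonneg p C) h.le,
      ← Finset.sum_div]
    exact ENNReal.ofReal_le_ofReal ((div_le_iff₀ h).2 hδ)
  calc _ ≤ ∑ p ∈ P, ENNReal.ofReal (pointCost p C / cost P C) * (a + if Q p then b else 0) := by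
        refine Finset.sum_le_sum fun p hp => ?_
        gcongr
        exact hf p hp
    _ = (∑ p ∈ P, ENNReal.ofReal (pointCost p C / cost P C)) * a +
        (∑ p ∈ P.filter Q, ENNReal.ofReal (pointCost p C / cost P C)) * b := by
        simp only [mul_add, Finset.sum_add_distrib, mul_ite, mul_zero, Finset.sum_mul,
          Finset.sum_filter, ite_mul, zero_mul]
    _ ≤ _ := by
        rw [sum_weights P C h, one_mul, mul_comm b]
        gcongr

theorem expect_uniformOfFinset_le {P : Finset (Pt d)} (hP : P.Nonempty) {Q : Pt d → Prop}
    [DecidablePred Q] {δ : ℝ}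
    (hδ : ((P.filter Q).card : ℝ) ≤ δ * P.card) {f : Pt d → ℝ≥0∞}
    (hf : ∀ p ∈ P, f p ≤ if Q p then 1 else 0) :
    expect (PMF.uniformOfFinset P hP) f ≤ ENNReal.ofReal δ := by
  have hc : (0 : ℝ) < P.card := by exact_mod_cast hP.card_pos
  have hc' : (P.card : ℝ≥0∞)⁻¹ = ENNReal.ofReal (P.card : ℝ)⁻¹ := by
    rw [ENNReal.ofReal_inv_of_pos hc, ENNReal.ofReal_natCast]
  calc expect (PMF.uniformOfFinset P hP) f
      ≤ ∑ p ∈ P, (P.card : ℝ≥0∞)⁻¹ * if Q p then 1 else 0 := by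
        rw [expect, tsum_eq_sum (s := P)]
        · refine Finset.sum_le_sum fun p hp => ?_
          rw [PMF.uniformOfFinset_apply, if_pos hp]
          gcongr
          exact hf p hp
        · intro p hp
          rw [PMF.uniformOfFinset_apply, if_neg hp, zero_mul]
    _ = ENNReal.ofReal ((P.filter Q).card * (P.card : ℝ)⁻¹) := by
        simp only [mul_ite, mul_one, mul_zero]
        rw [← Finset.sum_filter, Finset.sum_const, nsmul_eq_mul, hc',
          ENNReal.ofReal_mul (Nat.cast_nonneg _), ENNReal.ofReal_natCast]
    _ ≤ _ := ENNReal.ofReal_le_ofReal (by rwa [← div_eq_mul_inv, div_le_iff₀ hc])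

theorem mem_of_mem_support_d2Sample {P : Finset (Pt d)} {hP : P.Nonempty} {C : Finset (Pt d)}
    {p : Pt d} (hp : p ∈ (d2Sample P hP C).support) : p ∈ P ∧ (0 < cost P C → p ∉ C) := by
  rw [PMF.mem_support_iff] at hp
  by_cases h : 0 < cost P C
  · rw [d2Sample, dif_pos h, PMF.ofFinset_apply] at hp
    by_cases hpP : p ∈ P
    · rw [if_pos hpP] at hp
      refine ⟨hpP, fun _ hpC => hp ?_⟩
      rw [pointCost_of_mem hpC, zero_div, ENNReal.ofReal_zero]
    · rw [if_neg hpP] at hp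
      exact absurd rfl hp
  · rw [d2Sample, dif_neg h, PMF.uniformOfFinset_apply] at hp
    refine ⟨?_, fun h' => absurd h' h⟩
    by_contra hpP
    rw [if_neg hpP] at hp
    exact hp rfl

/-- The sets of centers that the algorithm can reach after sampling `n` centers. -/
def Reachable (P : Finset (Pt d)) (n : ℕ) (C : Finset (Pt d)) : Prop :=
  C ⊆ P ∧ C.Nonempty ∧ (0 < cost P C → C.card = n)

/-- At positive cost, a point of `C` has sampling weight zero, so every draw is a new center. -/
theorem reachable_of_mem_support_seedingRounds {P : Finset (Pt d)} (hP : P.Nonempty) (n : ℕ) :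
    ∀ C ∈ (seedingRounds P hP n).support, Reachable P (n + 1) C := by
  induction n with
  | zero =>
    intro C hC
    rw [seedingRounds, PMF.mem_support_map_iff] at hC
    obtain ⟨p, hp, rfl⟩ := hC
    rw [PMF.mem_support_uniformOfFinset_iff] at hp
    exact ⟨by simpa using hp, by simp, fun _ => by simp⟩
  | succ n ih =>
    intro C hC
    rw [seedingRounds, PMF.mem_support_bind_iff] at hC
    obtain ⟨C₀, hC₀, hC⟩ := hC
    rw [PMF.mem_support_map_iff] at hC
    obtain ⟨p, hp, rfl⟩ := hC
    obtain ⟨hpP, hpC⟩ := mem_of_mem_support_d2Sample hp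
    obtain ⟨h1, h2, h3⟩ := ih C₀ hC₀
    refine ⟨Finset.insert_subset hpP h1, Finset.insert_nonempty _ _, fun h => ?_⟩
    have hpos : 0 < cost P C₀ := h.trans_le (cost_anti P h2 (Finset.subset_insert _ _))
    rw [Finset.card_insert_of_notMem (hpC hpos), h3 hpos]

/-- The centers after a local search step that samples `p`. -/
def searchStep (P : Finset (Pt d)) (pick : Finset (Pt d) → Pt d → Pt d) (C : Finset (Pt d))
    (p : Pt d) : Finset (Pt d) :=
  if cost P (swap C (pick C p) p) < cost P C then swap C (pick C p) p else C

theorem localSearchStep_eq (P : Finset (Pt d)) (hP : P.Nonempty)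
    (pick : Finset (Pt d) → Pt d → Pt d) (C : Finset (Pt d)) :
    localSearchStep P hP pick C = (d2Sample P hP C).map (searchStep P pick C) := rfl

theorem cost_searchStep_le (P : Finset (Pt d)) (pick : Finset (Pt d) → Pt d → Pt d)
    (C : Finset (Pt d)) (p : Pt d) : cost P (searchStep P pick C p) ≤ cost P C := by
  rw [searchStep]
  split_ifs with h
  · exact h.le
  · exact le_rfl

section Rule

variable {P : Finset (Pt d)} {pick : Finset (Pt d) → Pt d → Pt d} {C : Finset (Pt d)} {p : Pt d}

theorem deficit_searchStep_le (hpick : IsArgminRule P pick) (hCP : C ⊆ P) (hC : C.Nonempty)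
    (hp : p ∈ P) (F : Finset (Pt d)) (T : ℝ) :
    deficit P F T (searchStep P pick C p) ≤ deficit P F T C + 1 := by
  rw [searchStep]
  split_ifs
  · exact deficit_swap_le P F T (hpick C hCP hC p hp).1 p
  · exact Nat.le_succ _

theorem deficit_searchStep_le_of_not_idle (hpick : IsArgminRule P pick) (hCP : C ⊆ P)
    (hC : C.Nonempty) (hp : p ∈ P) {F : Finset (Pt d)} (hF : F.Nonempty) {T : ℝ}
    (hi : ¬ Idle P F T C p) : deficit P F T (searchStep P pick C p) ≤ deficit P F T C := by
  rw [searchStep]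
  split_ifs
  · exact deficit_swap_le_of_not_idle hF (hpick C hCP hC p hp).1 hi
  · exact le_rfl

theorem cost_searchStep_le_of_improves (hpick : IsArgminRule P pick) (hCP : C ⊆ P)
    (hC : C.Nonempty) (hp : p ∈ P) {r : ℝ} (hi : Improves P C r p) :
    cost P (searchStep P pick C p) ≤ r * cost P C := by
  obtain ⟨q, hq, hle⟩ := hi
  have h := ((hpick C hCP hC p hp).2 q hq).trans hle
  rw [searchStep]
  split_ifs with h'
  · exact h
  · exact (not_lt.1 h').trans h

theorem reachable_of_mem_support_localSearchStep (hP : P.Nonempty) (hpick : IsArgminRule P pick)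
    {k : ℕ} (hC : Reachable P k C) :
    ∀ C' ∈ (localSearchStep P hP pick C).support, Reachable P k C' := by
  intro C' hC'
  rw [localSearchStep_eq, PMF.mem_support_map_iff] at hC'
  obtain ⟨p, hp, rfl⟩ := hC'
  obtain ⟨hpP, hpC⟩ := mem_of_mem_support_d2Sample hp
  have hpk := (hpick C hC.1 hC.2.1 p hpP).1
  rw [searchStep]
  split_ifs with h
  · have hpos : 0 < cost P C := (cost_nonneg _ _).trans_lt h
    refine ⟨Finset.insert_subset hpP ((Finset.erase_subset _ _).trans hC.1),
      Finset.insert_nonempty _ _, fun _ => ?_⟩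
    rw [swap, Finset.card_insert_of_notMem fun hh => hpC hpos (Finset.mem_of_mem_erase hh),
      Finset.card_erase_add_one hpk, hC.2.2 hpos]
  · exact hC

end Rule

/-! ### The deficit along the algorithm -/

/-- A function of the deficit at threshold `T`, cut off at cost `T² cost P F`. -/
def guarded (P F : Finset (Pt d)) (T : ℝ) (φ : ℕ → ℝ≥0∞) (C : Finset (Pt d)) : ℝ≥0∞ :=
  if T ^ 2 * cost P F < cost P C then φ (deficit P F T C) else 0

theorem guarded_of_lt {P F : Finset (Pt d)} {T : ℝ} {φ : ℕ → ℝ≥0∞} {C : Finset (Pt d)}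
    (h : T ^ 2 * cost P F < cost P C) : guarded P F T φ C = φ (deficit P F T C) :=
  if_pos h

theorem guarded_le {P F : Finset (Pt d)} {T : ℝ} {φ : ℕ → ℝ≥0∞} (hφ : Monotone φ)
    {C : Finset (Pt d)} {n : ℕ} (h : deficit P F T C ≤ n) : guarded P F T φ C ≤ φ n := by
  rw [guarded]
  split_ifs
  · exact hφ h
  · exact zero_le

/-- One estimate for both seeding and local search. Costs never increase, so once the cutoff applies
it applies forever, and the idle bound is needed only above it. -/
theorem expect_d2Sample_guarded_le {P : Finset (Pt d)} (hP : P.Nonempty) {F : Finset (Pt d)}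
    (hF : F.Nonempty) {T : ℝ} (hT : 20 ≤ T) {φ : ℕ → ℝ≥0∞} (hφ : Monotone φ)
    {C : Finset (Pt d)} (hC : C.Nonempty) {b : ℝ≥0∞}
    (hb : φ (deficit P F T C + 1) ≤ φ (deficit P F T C) + b) {next : Pt d → Finset (Pt d)}
    (hcost : ∀ p ∈ P, cost P (next p) ≤ cost P C)
    (hdef : ∀ p ∈ P, deficit P F T (next p) ≤ deficit P F T C + 1)
    (hidle : ∀ p ∈ P, ¬ Idle P F T C p → deficit P F T (next p) ≤ deficit P F T C) :
    expect (d2Sample P hP C) (fun p => guarded P F T φ (next p)) ≤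
      if T ^ 2 * cost P F < cost P C then
        φ (deficit P F T C) + b * ENNReal.ofReal (20 / T) else 0 := by
  split_ifs with h
  · have hpos : 0 < cost P C :=
      (mul_nonneg (sq_nonneg T) (cost_nonneg P F)).trans_lt h
    refine expect_d2Sample_le hP hpos (sum_idle_le P hF hT hC h) fun p hp => ?_
    split_ifs with hi
    · exact (guarded_le hφ (hdef p hp)).trans hb
    · rw [add_zero]
      exact guarded_le hφ (hidle p hp hi)
  · refine expect_le_of_forall fun p hp => ?_
    rw [guarded, if_neg]
    exact fun h' => h (h'.trans_le (hcost p (mem_of_mem_support_d2Sample hp).1))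

theorem monotone_two_pow : Monotone fun n : ℕ => (2 : ℝ≥0∞) ^ n :=
  fun _ _ h => pow_le_pow_right₀ one_le_two h

theorem expect_d2Sample_guarded_two_pow_le {P : Finset (Pt d)} (hP : P.Nonempty)
    {F : Finset (Pt d)} (hF : F.Nonempty) {T : ℝ} (hT : 20 ≤ T) {C : Finset (Pt d)}
    (hC : C.Nonempty) {next : Pt d → Finset (Pt d)}
    (hcost : ∀ p ∈ P, cost P (next p) ≤ cost P C)
    (hdef : ∀ p ∈ P, deficit P F T (next p) ≤ deficit P F T C + 1)
    (hidle : ∀ p ∈ P, ¬ Idle P F T C p → deficit P F T (next p) ≤ deficit P F T C) :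
    expect (d2Sample P hP C) (fun p => guarded P F T (fun n => 2 ^ n) (next p)) ≤
      (1 + ENNReal.ofReal (20 / T)) * guarded P F T (fun n => 2 ^ n) C := by
  refine (expect_d2Sample_guarded_le hP hF hT monotone_two_pow hC
    (b := 2 ^ deficit P F T C) (by rw [pow_succ, mul_two]) hcost hdef hidle).trans (le_of_eq ?_)
  rw [guarded]
  split_ifs
  · ring
  · rw [mul_zero]

theorem expect_seedingRounds_guarded_two_pow_le {P : Finset (Pt d)} (hP : P.Nonempty)
    {F : Finset (Pt d)} (hF : F.Nonempty) {T : ℝ} (hT : 20 ≤ T) (n : ℕ) :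
    expect (seedingRounds P hP n) (guarded P F T fun n => 2 ^ n) ≤
      2 * (1 + ENNReal.ofReal (20 / T)) ^ n := by
  induction n with
  | zero =>
    rw [seedingRounds, expect_map, pow_zero, mul_one]
    refine expect_le_of_forall fun p _ => (guarded_le monotone_two_pow (n := 1) ?_).trans
      (pow_one _).le
    simpa using deficit_le_card P F T {p}
  | succ n ih =>
    rw [seedingRounds, expect_bind]
    calc _ ≤ expect (seedingRounds P hP n) fun C =>
          (1 + ENNReal.ofReal (20 / T)) * guarded P F T (fun n => 2 ^ n) C := by
          refine expect_mono fun C hC => ?_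
          have hr := reachable_of_mem_support_seedingRounds hP n C hC
          rw [expect_map]
          exact expect_d2Sample_guarded_two_pow_le hP hF hT hr.2.1
            (fun p _ => cost_anti P hr.2.1 (Finset.subset_insert _ _))
            (fun p _ => deficit_insert_le P F T C p)
            (fun p _ hi => deficit_insert_le_of_not_idle hF hi)
      _ ≤ (1 + ENNReal.ofReal (20 / T)) * (2 * (1 + ENNReal.ofReal (20 / T)) ^ n) := by
          rw [expect_const_mul]
          gcongr
      _ = _ := by ring

/-- The linear version of the estimate is for huge `T`: the expected deficit is then below one, and
Markov's inequality makes it zero with high probability. The uniform first draw must therefore also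
be counted with probability `20 / T`. -/
theorem expect_seedingRounds_guarded_cast_le {P : Finset (Pt d)} (hP : P.Nonempty)
    {F : Finset (Pt d)} (hF : F.Nonempty) {T : ℝ} (hT : 20 ≤ T) (n : ℕ) :
    expect (seedingRounds P hP n) (guarded P F T fun n => (n : ℝ≥0∞)) ≤
      (n + 1) * ENNReal.ofReal (20 / T) := by
  have hmono : Monotone fun n : ℕ => (n : ℝ≥0∞) := Nat.mono_cast
  induction n with
  | zero =>
    rw [seedingRounds, expect_map, Nat.cast_zero, zero_add, one_mul]
    refine expect_uniformOfFinset_le hP (Q := fun p => ¬ Serves P F T p (nearest F p)) ?_ ?_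
    · have h := card_not_serves_mul_le P hF T
      have hT0 : 0 < T := by linarith
      rw [div_mul_eq_mul_div, le_div_iff₀ hT0]
      have h0 : (0 : ℝ) ≤ (P.filter fun p => ¬ Serves P F T p (nearest F p)).card :=
        Nat.cast_nonneg _
      have h1 : (0 : ℝ) ≤ P.card := Nat.cast_nonneg _
      nlinarith [mul_nonneg h0 (sub_nonneg.2 hT)]
    · intro p _
      by_cases h : Serves P F T p (nearest F p)
      swap
      · rw [if_pos h]
        refine (guarded_le hmono (n := 1) ?_).trans Nat.cast_one.le
        simpa using deficit_le_card P F T {p}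
      · rw [if_neg (not_not.2 h)]
        refine (guarded_le hmono (n := 0) ?_).trans Nat.cast_zero.le
        -- The first center is treated as an insertion into the empty set, which has deficit zero.
        have hi : ¬ Idle P F T ∅ p := by simpa [Idle] using h
        refine (deficit_insert_le_of_not_idle hF hi).trans ?_
        simpa using deficit_le_card P F T ∅
  | succ n ih =>
    rw [seedingRounds, expect_bind]
    calc _ ≤ expect (seedingRounds P hP n) fun C =>
          guarded P F T (fun n => (n : ℝ≥0∞)) C + ENNReal.ofReal (20 / T) := by
          refine expect_mono fun C hC => ?_
          have hr := reachable_of_mem_support_seedingRounds hP n C hC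
          rw [expect_map]
          refine (expect_d2Sample_guarded_le hP hF hT hmono hr.2.1 (b := 1) (by simp)
            (fun p _ => cost_anti P hr.2.1 (Finset.subset_insert _ _))
            (fun p _ => deficit_insert_le P F T C p)
            (fun p _ hi => deficit_insert_le_of_not_idle hF hi)).trans ?_
          rw [guarded]
          split_ifs
          · rw [one_mul]
          · exact zero_le
      _ ≤ (n + 1) * ENNReal.ofReal (20 / T) + ENNReal.ofReal (20 / T) := by
          rw [expect_add, expect_const]
          gcongr
      _ = _ := by push_cast; ring

theorem reachable_of_mem_support_seeding {P : Finset (Pt d)} (hP : P.Nonempty) {k : ℕ}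
    (hk : 1 ≤ k) : ∀ C ∈ (seeding P hP k).support, Reachable P k C := by
  have := reachable_of_mem_support_seedingRounds hP (k - 1)
  rwa [Nat.sub_add_cancel hk] at this

theorem reachable_of_mem_support {P : Finset (Pt d)} (hP : P.Nonempty)
    {pick : Finset (Pt d) → Pt d → Pt d} (hpick : IsArgminRule P pick) {k : ℕ} (hk : 1 ≤ k)
    (l : ℕ) : ∀ C ∈ (seedingThenLocalSearch P hP pick k l).support, Reachable P k C := by
  induction l with
  | zero => exact reachable_of_mem_support_seeding hP hk
  | succ l ih =>
    intro C hC
    rw [seedingThenLocalSearch, PMF.mem_support_bind_iff] at hC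
    obtain ⟨C₀, hC₀, hC⟩ := hC
    exact reachable_of_mem_support_localSearchStep hP hpick (ih C₀ hC₀) C hC

theorem expect_guarded_two_pow_le {P : Finset (Pt d)} (hP : P.Nonempty)
    {pick : Finset (Pt d) → Pt d → Pt d} (hpick : IsArgminRule P pick) {F : Finset (Pt d)}
    (hF : F.Nonempty) {T : ℝ} (hT : 20 ≤ T) {k : ℕ} (hk : 1 ≤ k) (l : ℕ) :
    expect (seedingThenLocalSearch P hP pick k l) (guarded P F T fun n => 2 ^ n) ≤
      2 * (1 + ENNReal.ofReal (20 / T)) ^ (k + l) := by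
  induction l with
  | zero =>
    refine (expect_seedingRounds_guarded_two_pow_le hP hF hT (k - 1)).trans ?_
    gcongr
    · exact le_self_add
    · omega
  | succ l ih =>
    rw [seedingThenLocalSearch, expect_bind]
    calc _ ≤ expect (seedingThenLocalSearch P hP pick k l) fun C =>
          (1 + ENNReal.ofReal (20 / T)) * guarded P F T (fun n => 2 ^ n) C := by
          refine expect_mono fun C hC => ?_
          have hr := reachable_of_mem_support hP hpick hk l C hC
          rw [localSearchStep_eq, expect_map]
          exact expect_d2Sample_guarded_two_pow_le hP hF hT hr.2.1
            (fun p _ => cost_searchStep_le P pick C p)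
            (fun p hp => deficit_searchStep_le hpick hr.1 hr.2.1 hp F T)
            (fun p hp hi => deficit_searchStep_le_of_not_idle hpick hr.1 hr.2.1 hp hF hi)
      _ ≤ (1 + ENNReal.ofReal (20 / T)) * (2 * (1 + ENNReal.ofReal (20 / T)) ^ (k + l)) := by
          rw [expect_const_mul]
          gcongr
      _ = _ := by rw [← add_assoc]; ring

/-- With high probability, the cost is crudely bounded at all times. -/
theorem expect_cost_gt_le {P : Finset (Pt d)} (hP : P.Nonempty)
    (pick : Finset (Pt d) → Pt d → Pt d) {F : Finset (Pt d)}
    (hF : F.Nonempty) {T : ℝ} (hT : 20 ≤ T) {k : ℕ} (hk : 1 ≤ k) (hFk : F.card ≤ k) (l : ℕ) :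
    expect (seedingThenLocalSearch P hP pick k l)
      (fun C => if T ^ 2 * cost P F < cost P C then 1 else 0) ≤
      k * ENNReal.ofReal (20 / T) := by
  induction l with
  | zero =>
    have h := expect_seedingRounds_guarded_cast_le hP hF hT (k - 1)
    have hk' : ((k - 1 : ℕ) : ℝ≥0∞) + 1 = k := by
      exact_mod_cast Nat.sub_add_cancel hk
    rw [hk'] at h
    refine le_trans (expect_mono fun C hC => ?_) h
    have hr := reachable_of_mem_support_seeding hP hk C hC
    split_ifs with hlt
    · rw [guarded_of_lt hlt]
      have hF0 := cost_nonneg P F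
      have hpos : 0 < cost P C := (mul_nonneg (sq_nonneg T) hF0).trans_lt hlt
      -- The deficit is an integer: if it is not at least one, then every cluster is served and the
      -- cost is at most `T * cost P F`, against the guard.
      by_contra hdef
      have h0 : deficit P F T C = 0 := by
        by_contra h1
        exact hdef (by exact_mod_cast Nat.one_le_iff_ne_zero.2 h1)
      have h2 := cost_le_of_deficit_eq_zero P hF (by linarith : 0 ≤ T)
        (hFk.trans (hr.2.2 hpos).ge) h0
      have h3 : T * cost P F ≤ T ^ 2 * cost P F := by
        gcongr
        nlinarith
      linarith
    · exact zero_le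
  | succ l ih =>
    rw [seedingThenLocalSearch, expect_bind]
    refine (expect_mono fun C _ => ?_).trans ih
    rw [localSearchStep_eq, expect_map]
    refine expect_le_of_forall fun p _ => ?_
    have := cost_searchStep_le P pick C p
    split_ifs with h1 h2
    · exact le_rfl
    · exact absurd (h1.trans_le this) h2
    · exact zero_le
    · exact le_rfl

/-! ### Progress of local search and the contracting potential -/

/-- A decreasing function of the approximation ratio `x` that grows by at least one in each
successful local search step. -/
def progress (k M x : ℝ) : ℝ := 4000 * k / √x - 500 * k / M * Real.log x

theorem progress_anti {k M x y : ℝ} (hk : 0 ≤ k) (hM : 0 < M) (hx : 0 < x) (hxy : x ≤ y) :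
    progress k M y ≤ progress k M x := by
  have h1 : 4000 * k / √y ≤ 4000 * k / √x := by
    have := Real.sqrt_pos.2 hx
    gcongr
  have h2 : 500 * k / M * Real.log x ≤ 500 * k / M * Real.log y := by gcongr
  rw [progress, progress]
  linarith

/-- At the capped scale `m = M` the logarithm gains at least `500 / 484`. Otherwise `√x / 4 ≤ m`,
and the term `4000 * k / √x` gains at least `4000 / (4 * 968)`. Each term is monotone, so the other
one never works against it. -/
theorem progress_add_one_le {k M m x y : ℝ} (hk : 0 < k) (hM : 0 < M) (hm : 0 < m) (hmk : m ≤ k)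
    (hmx : m = M ∨ √x / 4 ≤ m) (hx : 0 < x) (hy : 0 < y) (hyx : y ≤ (1 - m / (484 * k)) * x) :
    progress k M x + 1 ≤ progress k M y := by
  set r := m / (484 * k) with hr
  have hr0 : 0 < r := by positivity
  have hr1 : r < 1 := by
    rw [hr, div_lt_one (by positivity)]; linarith
  have hyx' : y ≤ x := hyx.trans (by nlinarith)
  have hsx := Real.sqrt_pos.2 hx
  have hsy := Real.sqrt_pos.2 hy
  have h1 : 4000 * k / √x ≤ 4000 * k / √y := by gcongr
  have h2 : 500 * k / M * Real.log y ≤ 500 * k / M * Real.log x := by gcongr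
  rw [progress, progress]
  rcases hmx with rfl | hmx
  · have h3 : Real.log y ≤ Real.log x - r := by
      have h4 := Real.log_le_log hy hyx
      rw [Real.log_mul (by linarith) hx.ne'] at h4
      have h5 := Real.log_le_sub_one_of_pos (by linarith : 0 < 1 - r)
      linarith
    have h4 : 500 * k / m * Real.log y ≤ 500 * k / m * (Real.log x - r) := by gcongr
    have h5 : 500 * k / m * r = 500 / 484 := by rw [hr]; field_simp
    rw [mul_sub, h5] at h4
    linarith
  · have h3 : √y ≤ (1 - r / 2) * √x := by
      rw [Real.sqrt_le_left (by nlinarith), mul_pow, Real.sq_sqrt hx.le]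
      nlinarith [mul_nonneg (sq_nonneg r) hx.le]
    have h4 : (1 + r / 2) * √y ≤ √x := by
      have : (1 + r / 2) * √y ≤ (1 + r / 2) * ((1 - r / 2) * √x) := by gcongr
      nlinarith [mul_nonneg (sq_nonneg r) hsx.le]
    have h5 : 4000 * k / √x * (1 + r / 2) ≤ 4000 * k / √y := by
      rw [div_mul_eq_mul_div, div_le_div_iff₀ hsx hsy, mul_assoc]
      gcongr
    have h6 : 1 ≤ 4000 * k / √x * (r / 2) := by
      have : 4000 * k / √x * (r / 2) = 4000 / 968 * m / √x := by rw [hr]; field_simp; norm_num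
      rw [this, le_div_iff₀ hsx]
      linarith
    linarith

/-- The witness is `min ⌊√x / 2⌋₊ M`: small enough for the guard `m² < x`, and of order `√x` unless
capped. -/
theorem exists_scale {x : ℝ} (hx : 10 ^ 8 ≤ x) {M : ℕ} (hM : 1000 ≤ M) :
    ∃ m ∈ Finset.Icc 1000 M, (m : ℝ) ^ 2 < x ∧ (m = M ∨ √x / 4 ≤ m) := by
  have hs : 10 ^ 4 ≤ √x := Real.le_sqrt_of_sq_le (by norm_num; linarith)
  have hsq : √x ^ 2 = x := Real.sq_sqrt (by linarith)
  have h1 : (⌊√x / 2⌋₊ : ℝ) ≤ √x / 2 := Nat.floor_le (by positivity)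
  have h2 : √x / 2 < ⌊√x / 2⌋₊ + 1 := Nat.lt_floor_add_one _
  have h3 : 1000 ≤ ⌊√x / 2⌋₊ := Nat.le_floor (by push_cast; linarith)
  refine ⟨min ⌊√x / 2⌋₊ M, Finset.mem_Icc.2 ⟨le_min h3 hM, min_le_right _ _⟩, ?_, ?_⟩
  · have h4 : ((min ⌊√x / 2⌋₊ M : ℕ) : ℝ) ≤ √x / 2 :=
      le_trans (by exact_mod_cast min_le_left _ _) h1
    have h5 : (0 : ℝ) ≤ (min ⌊√x / 2⌋₊ M : ℕ) := Nat.cast_nonneg _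
    nlinarith
  · rcases min_choice ⌊√x / 2⌋₊ M with h | h
    · right
      rw [h]
      linarith
    · exact Or.inl h

/-- The bound on the deficit at scale `m`. -/
def budget (k m : ℕ) : ℕ := ⌈120 * (k : ℝ) / m⌉₊

/-- Since `m ≤ k`, rounding up costs at most `k / m`, so the budget is at most `121 * k / m`; and
`484 = 4 * 121`. -/
theorem div_le_one_div_budget {k m : ℕ} (hm : 1 ≤ m) (hmk : m ≤ k) :
    (m : ℝ) / (484 * k) ≤ 1 / (4 * budget k m) := by
  have hm0 : (0 : ℝ) < m := by exact_mod_cast hm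
  have hmk' : (m : ℝ) ≤ k := by exact_mod_cast hmk
  have h1 : (1 : ℝ) ≤ k / m := by rwa [le_div_iff₀ hm0, one_mul]
  have h2 : (budget k m : ℝ) < 120 * (k : ℝ) / m + 1 := Nat.ceil_lt_add_one (by positivity)
  have h3 : 120 * (k : ℝ) / m ≤ budget k m := Nat.le_ceil _
  have h4 : 120 * (k : ℝ) / m = 120 * (k / m) := by ring
  have h5 : (m : ℝ) / (484 * k) = 1 / (4 * (121 * (k / m))) := by
    have : (k : ℝ) ≠ 0 := by linarith
    field_simp
    norm_num
  rw [h5]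
  gcongr
  · linarith
  · linarith

/-- The potential that contracts under local search: it is zero at cost at most `B cost P F` and
increases to one at cost `X cost P F`. -/
def potential (P F : Finset (Pt d)) (k M B X : ℝ) (C : Finset (Pt d)) : ℝ≥0∞ :=
  if B * cost P F < cost P C then
    ENNReal.ofReal (min 1 (Real.exp (progress k M X - progress k M (cost P C / cost P F)))) else 0

theorem potential_le_one (P F : Finset (Pt d)) (k M B X : ℝ) (C : Finset (Pt d)) :
    potential P F k M B X C ≤ 1 := by
  rw [potential]
  split_ifs
  · exact ENNReal.ofReal_le_one.2 (min_le_left _ _)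
  · exact zero_le

theorem one_le_mul_potential {P F : Finset (Pt d)} {k M B X : ℝ} (hk : 0 ≤ k) (hM : 0 < M)
    (hB : 0 < B) (hBX : B ≤ X) (hF0 : 0 < cost P F) {C : Finset (Pt d)}
    (h : B * cost P F < cost P C) :
    1 ≤ ENNReal.ofReal (Real.exp (progress k M B - progress k M X)) *
      potential P F k M B X C := by
  have h1 : B ≤ cost P C / cost P F := (le_div_iff₀ hF0).2 h.le
  have h2 := progress_anti hk hM hB h1
  have h3 := progress_anti hk hM hB hBX
  have h4 : Real.exp (progress k M X - progress k M B) ≤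
      min 1 (Real.exp (progress k M X - progress k M (cost P C / cost P F))) :=
    le_min (Real.exp_le_one_iff.2 (by linarith)) (Real.exp_le_exp.2 (by linarith))
  rw [potential, if_pos h, ← ENNReal.ofReal_mul (Real.exp_pos _).le, ← ENNReal.ofReal_one]
  refine ENNReal.ofReal_le_ofReal ?_
  calc (1 : ℝ) = Real.exp (progress k M B - progress k M X) *
        Real.exp (progress k M X - progress k M B) := by
        rw [← Real.exp_add, sub_add_sub_cancel, sub_self, Real.exp_zero]
    _ ≤ _ := by gcongr

theorem expect_localSearchStep_potential_le {P : Finset (Pt d)} (hP : P.Nonempty)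
    {pick : Finset (Pt d) → Pt d → Pt d} (hpick : IsArgminRule P pick) {F : Finset (Pt d)}
    (hF : F.Nonempty) (hF0 : 0 < cost P F) {k M : ℕ} (hFk : F.card ≤ k) (hM : 1000 ≤ M)
    (hMk : M ≤ k) {B X : ℝ} (hB : 10 ^ 8 ≤ B) {C : Finset (Pt d)} (hC : Reachable P k C)
    (hX : cost P C ≤ X * cost P F)
    (hdef : ∀ m ∈ Finset.Icc 1000 M, (m : ℝ) ^ 2 * cost P F < cost P C →
      deficit P F m C ≤ budget k m) :
    expect (localSearchStep P hP pick C) (potential P F k M B X) ≤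
      ENNReal.ofReal (4 / 5) * potential P F k M B X C := by
  rw [localSearchStep_eq, expect_map]
  have hM0 : (0 : ℝ) < M := by exact_mod_cast (by omega : 0 < M)
  have hk0 : (0 : ℝ) < k := by exact_mod_cast (by omega : 0 < k)
  by_cases h : B * cost P F < cost P C
  swap
  · refine expect_le_of_forall fun p _ => ?_
    rw [potential, if_neg]
    · exact zero_le
    · exact fun h' => h (h'.trans_le (cost_searchStep_le P pick C p))
  have hpos : 0 < cost P C := (mul_pos (by linarith) hF0).trans h
  set x := cost P C / cost P F with hx
  have hxB : B ≤ x := (le_div_iff₀ hF0).2 h.le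
  have hx0 : 0 < x := by positivity
  obtain ⟨m, hm, hmx, hmM⟩ := exists_scale (hB.trans hxB) hM
  obtain ⟨hm1, hm2⟩ := Finset.mem_Icc.1 hm
  have hguard : (m : ℝ) ^ 2 * cost P F < cost P C := by rwa [hx, lt_div_iff₀ hF0] at hmx
  have hm0 : (1000 : ℝ) ≤ m := by exact_mod_cast hm1
  have hsum := sum_not_improves_le P hF hC.2.1 (hFk.trans (hC.2.2 hpos).ge) hm0 hguard
    (D := budget k m) (by exact_mod_cast hdef m hm hguard)
  set r := Real.exp (progress k M X - progress k M x) with hr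
  have hr1 : r ≤ 1 := by
    have hxX : x ≤ X := (div_le_iff₀ hF0).2 hX
    have := progress_anti hk0.le hM0 hx0 hxX
    exact Real.exp_le_one_iff.2 (by linarith)
  have hV : potential P F k M B X C = ENNReal.ofReal r := by
    rw [potential, if_pos h, min_eq_right hr1]
  have hr0 : 0 < r := Real.exp_pos _
  -- Success divides the potential by `e ≥ 2`, and failure, of probability at most `3/5`, leaves it
  -- no larger: `1/2 + 1/2 * 3/5 = 4/5`.
  calc _ ≤ ENNReal.ofReal (r / 2) + ENNReal.ofReal (r / 2) * ENNReal.ofReal (3 / 5) := by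
        refine expect_d2Sample_le hP hpos hsum fun p hp => ?_
        have hle := cost_searchStep_le P pick C p
        by_cases h' : B * cost P F < cost P (searchStep P pick C p)
        swap
        · rw [potential, if_neg h']
          exact zero_le
        have hpos' : 0 < cost P (searchStep P pick C p) := (mul_pos (by linarith) hF0).trans h'
        have hy0 : 0 < cost P (searchStep P pick C p) / cost P F := by positivity
        rw [potential, if_pos h']
        by_cases hi : Improves P C (1 - 1 / (4 * budget k m)) p
        · rw [if_neg (not_not.2 hi), add_zero]
          refine ENNReal.ofReal_le_ofReal ((min_le_right _ _).trans ?_)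
          have h1 := cost_searchStep_le_of_improves hpick hC.1 hC.2.1 hp hi
          have h2 := div_le_one_div_budget (by omega) (hm2.trans hMk)
          have h3 : cost P (searchStep P pick C p) / cost P F ≤
              (1 - (m : ℝ) / (484 * k)) * x := by
            rw [hx, ← mul_div_assoc]
            gcongr
            exact h1.trans (by gcongr)
          have h4 := progress_add_one_le hk0 hM0 (by linarith)
            (by exact_mod_cast hm2.trans hMk) (hmM.imp_left fun h => by rw [h]) hx0 hy0 h3
          have h5 : Real.exp (progress k M X -
              progress k M (cost P (searchStep P pick C p) / cost P F)) * Real.exp 1 ≤ r := by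
            rw [← Real.exp_add]
            exact Real.exp_le_exp.2 (by linarith)
          have h6 := Real.add_one_le_exp (1 : ℝ)
          have h7 := Real.exp_pos (progress k M X -
              progress k M (cost P (searchStep P pick C p) / cost P F))
          nlinarith
        · rw [if_pos hi, ← ENNReal.ofReal_add (by positivity) (by positivity), add_halves]
          refine ENNReal.ofReal_le_ofReal ((min_le_right _ _).trans (Real.exp_le_exp.2 ?_))
          have := progress_anti (y := x) hk0.le hM0 hy0 (by rw [hx]; gcongr)
          linarith
    _ = _ := by
        rw [hV, ← ENNReal.ofReal_mul (by positivity), ← ENNReal.ofReal_add (by positivity)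
          (by positivity), ← ENNReal.ofReal_mul (by norm_num)]
        congr 1
        ring

/-! ### Bad states and the union bound -/

/-- At least one if the cost exceeds `T² cost P F` or if the deficit exceeds its budget at some
scale. -/
def excess (P F : Finset (Pt d)) (k M : ℕ) (T : ℝ) (C : Finset (Pt d)) : ℝ≥0∞ :=
  (if T ^ 2 * cost P F < cost P C then 1 else 0) +
    ∑ m ∈ Finset.Icc 1000 M, (2 ^ budget k m)⁻¹ * guarded P F m (fun n => 2 ^ n) C

theorem cost_le_of_excess_lt_one {P F : Finset (Pt d)} {k M : ℕ} {T : ℝ} {C : Finset (Pt d)}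
    (h : excess P F k M T C < 1) : cost P C ≤ T ^ 2 * cost P F := by
  by_contra hlt
  rw [excess, if_pos (not_le.1 hlt)] at h
  exact absurd h (not_lt.2 le_self_add)

theorem deficit_le_of_excess_lt_one {P F : Finset (Pt d)} {k M : ℕ} {T : ℝ} {C : Finset (Pt d)}
    (h : excess P F k M T C < 1) {m : ℕ} (hm : m ∈ Finset.Icc 1000 M)
    (hlt : (m : ℝ) ^ 2 * cost P F < cost P C) : deficit P F m C ≤ budget k m := by
  by_contra hdef
  refine absurd h (not_lt.2 ?_)
  rw [excess]
  refine le_trans ?_ (le_add_left (Finset.single_le_sum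
    (f := fun m : ℕ => (2 ^ budget k m)⁻¹ * guarded P F m (fun n => 2 ^ n) C)
    (fun _ _ => zero_le) hm))
  have h2 : (2 : ℝ≥0∞) ^ budget k m ≠ 0 := pow_ne_zero _ two_ne_zero
  have h3 : (2 : ℝ≥0∞) ^ budget k m ≠ ∞ := ENNReal.pow_ne_top ENNReal.ofNat_ne_top
  rw [guarded_of_lt hlt, ← ENNReal.inv_mul_cancel h2 h3]
  gcongr
  · exact one_le_two
  · exact (not_le.1 hdef).le

/-- The expected growth is at most `exp (40k/m)`, while `log 2 > 2/3` makes `2 ^ (120k/m)` at least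
`exp (80k/m)`. -/
theorem pow_mul_inv_two_pow_budget_le {k m n : ℕ} (hm : 1 ≤ m) (hn : n ≤ 2 * k) :
    (1 + 20 / (m : ℝ)) ^ n * ((2 : ℝ) ^ budget k m)⁻¹ ≤ Real.exp (-(40 * k / m)) := by
  have hm0 : (0 : ℝ) < m := by exact_mod_cast hm
  have hn' : (n : ℝ) ≤ 2 * k := by exact_mod_cast hn
  have h1 : (1 + 20 / (m : ℝ)) ^ n ≤ Real.exp (40 * k / m) := by
    calc (1 + 20 / (m : ℝ)) ^ n ≤ Real.exp (20 / m) ^ n := by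
          gcongr
          rw [add_comm]
          exact Real.add_one_le_exp _
      _ = Real.exp (n * (20 / m)) := by rw [Real.exp_nat_mul]
      _ ≤ _ := by
          rw [Real.exp_le_exp, ← mul_div_assoc]
          exact div_le_div_of_nonneg_right (by linarith) hm0.le
  have h2 : Real.exp (80 * k / m) ≤ (2 : ℝ) ^ budget k m := by
    have h3 : 120 * (k : ℝ) / m ≤ budget k m := Nat.le_ceil _
    have h4 := Real.log_two_gt_d9
    rw [← Real.exp_log (by norm_num : (0 : ℝ) < 2), ← Real.exp_nat_mul, Real.exp_le_exp]
    have h5 : 80 * (k : ℝ) / m = 120 * k / m * (2 / 3) := by ring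
    rw [h5]
    gcongr
    linarith
  calc _ ≤ Real.exp (40 * k / m) * (Real.exp (80 * k / m))⁻¹ := by gcongr
    _ = _ := by
        rw [← Real.exp_neg, ← Real.exp_add]
        congr 1
        ring

theorem expect_excess_le {P : Finset (Pt d)} (hP : P.Nonempty)
    {pick : Finset (Pt d) → Pt d → Pt d} (hpick : IsArgminRule P pick) {F : Finset (Pt d)}
    (hF : F.Nonempty) {k M : ℕ} (hk : 1 ≤ k) (hFk : F.card ≤ k) {T : ℝ}
    (hT : 20 ≤ T) {l : ℕ} (hl : l ≤ k) :
    expect (seedingThenLocalSearch P hP pick k l) (excess P F k M T) ≤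
      ENNReal.ofReal (k * (20 / T) + M * (2 * Real.exp (-(40 * k / M)))) := by
  have hT0 : 0 < T := by linarith
  rw [ENNReal.ofReal_add (by positivity) (by positivity), ENNReal.ofReal_mul (by positivity),
    ENNReal.ofReal_natCast]
  rw [show excess P F k M T = fun C => (if T ^ 2 * cost P F < cost P C then 1 else 0) +
    ∑ m ∈ Finset.Icc 1000 M, (2 ^ budget k m)⁻¹ * guarded P F m (fun n => 2 ^ n) C from rfl,
    expect_add, expect_sum]
  refine add_le_add (expect_cost_gt_le hP pick hF hT hk hFk l) ?_
  have hm : ∀ m ∈ Finset.Icc 1000 M, expect (seedingThenLocalSearch P hP pick k l)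
      (fun C => (2 ^ budget k m)⁻¹ * guarded P F m (fun n => 2 ^ n) C) ≤
      ENNReal.ofReal (2 * Real.exp (-(40 * k / M))) := by
    intro m hm
    obtain ⟨hm1, hm2⟩ := Finset.mem_Icc.1 hm
    have hm0 : (1000 : ℝ) ≤ m := by exact_mod_cast hm1
    have hm0' : (0 : ℝ) < m := by linarith
    rw [expect_const_mul]
    calc _ ≤ (2 ^ budget k m)⁻¹ * (2 * (1 + ENNReal.ofReal (20 / m)) ^ (k + l)) := by
          gcongr
          exact expect_guarded_two_pow_le hP hpick hF (by linarith) hk l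
      _ = ENNReal.ofReal (((2 : ℝ) ^ budget k m)⁻¹ * (2 * (1 + 20 / (m : ℝ)) ^ (k + l))) := by
          rw [ENNReal.ofReal_mul (by positivity), ENNReal.ofReal_mul (by norm_num),
            ENNReal.ofReal_pow (by positivity), ENNReal.ofReal_add (by norm_num) (by positivity),
            ENNReal.ofReal_inv_of_pos (by positivity), ENNReal.ofReal_pow (by norm_num),
            ENNReal.ofReal_one, ENNReal.ofReal_ofNat]
      _ ≤ _ := by
          refine ENNReal.ofReal_le_ofReal ?_
          have h1 := pow_mul_inv_two_pow_budget_le (k := k) (m := m) (n := k + l) (by omega)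
            (by omega)
          have h2 : Real.exp (-(40 * k / m)) ≤ Real.exp (-(40 * k / M)) := by
            have : (m : ℝ) ≤ M := by exact_mod_cast hm2
            rw [Real.exp_le_exp]
            gcongr
          calc _ = 2 * ((1 + 20 / (m : ℝ)) ^ (k + l) * ((2 : ℝ) ^ budget k m)⁻¹) := by ring
            _ ≤ _ := by linarith
  calc _ ≤ ∑ m ∈ Finset.Icc 1000 M, ENNReal.ofReal (2 * Real.exp (-(40 * k / M))) :=
        Finset.sum_le_sum hm
    _ = (Finset.Icc 1000 M).card * ENNReal.ofReal (2 * Real.exp (-(40 * k / M))) := by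
        rw [Finset.sum_const, nsmul_eq_mul]
    _ ≤ M * ENNReal.ofReal (2 * Real.exp (-(40 * k / M))) := by
        gcongr
        rw [Nat.card_Icc]
        omega
    _ = _ := by rw [ENNReal.ofReal_mul (Nat.cast_nonneg _), ENNReal.ofReal_natCast]

/-- The probability that the cost stays above `B cost P F`. -/
theorem expect_cost_gt_le_of_pos {P : Finset (Pt d)} (hP : P.Nonempty)
    {pick : Finset (Pt d) → Pt d → Pt d} (hpick : IsArgminRule P pick) {F : Finset (Pt d)}
    (hF : F.Nonempty) (hF0 : 0 < cost P F) {k M : ℕ} (hFk : F.card ≤ k) (hM : 1000 ≤ M)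
    (hMk : M ≤ k) {B T : ℝ} (hB : 10 ^ 8 ≤ B) (hBT : B ≤ T ^ 2) (hT : 20 ≤ T) {l : ℕ}
    (hl : l ≤ k) :
    expect (seedingThenLocalSearch P hP pick k l)
      (fun C => if B * cost P F < cost P C then 1 else 0) ≤
      ENNReal.ofReal (Real.exp (progress k M B - progress k M (T ^ 2)) * (4 / 5) ^ l +
        l * (k * (20 / T) + M * (2 * Real.exp (-(40 * k / M))))) := by
  have hk : 1 ≤ k := by omega
  have hT0 : 0 < T := by linarith
  have hM0 : (0 : ℝ) < M := by exact_mod_cast (by omega : 0 < M)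
  refine (expect_chain_le (ν := seedingThenLocalSearch P hP pick k)
    (κ := localSearchStep P hP pick) (I := Reachable P k) (V := potential P F k M B (T ^ 2))
    (g := excess P F k M T) (r := ENNReal.ofReal (4 / 5))
    (c := ENNReal.ofReal (Real.exp (progress k M B - progress k M (T ^ 2)))) (fun _ => rfl)
    (fun C hC => reachable_of_mem_support_localSearchStep hP hpick hC)
    (reachable_of_mem_support hP hpick hk 0) (fun C _ => ?_) (fun C => ?_)
    (fun C hC hg => ?_) l).trans ?_
  · split_ifs with h
    · exact one_le_mul_potential (Nat.cast_nonneg _) hM0 (by linarith) hBT hF0 h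
    · exact zero_le
  · split_ifs
    · exact le_rfl
    · exact zero_le
  · exact expect_localSearchStep_potential_le hP hpick hF hF0 hFk hM hMk hB hC
      (cost_le_of_excess_lt_one hg) fun m hm => deficit_le_of_excess_lt_one hg hm
  · rw [ENNReal.ofReal_add (by positivity) (by positivity), ENNReal.ofReal_mul (by positivity),
      ENNReal.ofReal_pow (by norm_num)]
    refine add_le_add (mul_le_of_le_one_right'
      (expect_le_of_forall fun C _ => potential_le_one _ _ _ _ _ _ C)) ?_
    calc _ ≤ ∑ t ∈ Finset.range l,
          ENNReal.ofReal (k * (20 / T) + M * (2 * Real.exp (-(40 * k / M)))) :=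
        Finset.sum_le_sum fun t ht =>
          expect_excess_le hP hpick hF hk hFk hT ((Finset.mem_range.1 ht).le.trans hl)
      _ = _ := by
        rw [Finset.sum_const, Finset.card_range, nsmul_eq_mul,
          ENNReal.ofReal_mul (Nat.cast_nonneg _), ENNReal.ofReal_natCast]

/-! ### Choice of parameters and numerical estimates -/

/-- Here `x = k ^ (1/20)`. The descent from `T²` costs `O(x ^ 17)` in the exponent through the
logarithm, and reaching `B` costs a tiny multiple of `ε * k`. Both are beaten by the contraction
`exp (-(ε * k / 10))`, because `ε * k ≥ 10 ^ 4 * x ^ 19`. -/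
theorem exp_progress_mul_pow_le {x ε k M B T : ℝ} {l : ℕ} (hx : 10 ^ 4 ≤ x)
    (hε : 0 < ε) (hε1 : ε ≤ 1) (hεx : 10 ^ 4 ≤ ε * x) (hk : x ^ 20 = k) (hM : x ^ 5 / 2 ≤ M)
    (hB : B = 10 ^ 30 / ε ^ 3) (hT : T = k ^ 3 * Real.exp (x ^ 2)) (hl : ε * k / 2 ≤ l) :
    Real.exp (progress k M B - progress k M (T ^ 2)) * (4 / 5) ^ l ≤ Real.exp (-x ^ 2 - 2) := by
  have hx0 : 0 < x := by linarith
  have hk0 : 0 < k := by rw [← hk]; positivity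
  have hM0 : 0 < M := lt_of_lt_of_le (by positivity) hM
  have hB1 : 1 ≤ B := by
    rw [hB, le_div_iff₀ (by positivity), one_mul]
    exact (pow_le_one₀ hε.le hε1).trans (by norm_num)
  -- Only `10 ^ 30 / ε ^ 2 ≤ B` is used here.
  have hsB : 10 ^ 15 / ε ≤ √B := by
    refine Real.le_sqrt_of_sq_le ?_
    rw [hB, div_pow]
    norm_num only
    exact div_le_div_of_nonneg_left (by norm_num) (by positivity)
      (pow_le_pow_of_le_one hε.le hε1 (by norm_num))
  have hpB : progress k M B ≤ 4000 * (ε * k) / 10 ^ 15 := by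
    have h1 : 4000 * k / √B ≤ 4000 * k / (10 ^ 15 / ε) := by gcongr
    have h2 : 4000 * k / (10 ^ 15 / ε) = 4000 * (ε * k) / 10 ^ 15 := by
      field_simp
    have h3 : 0 ≤ 500 * k / M * Real.log B := by
      have := Real.log_nonneg hB1
      positivity
    rw [progress]
    linarith
  have hlog : Real.log (T ^ 2) ≤ 3 * x ^ 2 := by
    rw [Real.log_pow, hT, Real.log_mul (by positivity) (Real.exp_pos _).ne', Real.log_exp,
      Real.log_pow, ← hk, Real.log_pow]
    have := Real.log_le_sub_one_of_pos hx0
    push_cast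
    nlinarith
  have hpT : -progress k M (T ^ 2) ≤ 3000 * x ^ 17 := by
    have h1 : 0 ≤ 4000 * k / √(T ^ 2) := by positivity
    have h2 : 500 * k / M ≤ 1000 * x ^ 15 := by
      rw [div_le_iff₀ hM0, ← hk]
      have : 1000 * x ^ 15 * (x ^ 5 / 2) ≤ 1000 * x ^ 15 * M := by gcongr
      linarith
    have h3 : 500 * k / M * Real.log (T ^ 2) ≤ 1000 * x ^ 15 * (3 * x ^ 2) := by
      have : 500 * k / M * Real.log (T ^ 2) ≤ 500 * k / M * (3 * x ^ 2) := by gcongr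
      exact this.trans (by gcongr)
    rw [progress]
    linarith
  have hpow : ((4 : ℝ) / 5) ^ l ≤ Real.exp (-(ε * k / 10)) := by
    have h1 : (4 : ℝ) / 5 ≤ Real.exp (-(1 / 5)) := by
      have := Real.add_one_le_exp (-(1 / 5) : ℝ)
      linarith
    calc ((4 : ℝ) / 5) ^ l ≤ Real.exp (-(1 / 5)) ^ l := by gcongr
      _ = Real.exp (l * -(1 / 5)) := by rw [Real.exp_nat_mul]
      _ ≤ _ := Real.exp_le_exp.2 (by linarith)
  have hεk : 10 ^ 4 * x ^ 19 ≤ ε * k := by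
    have : ε * k = ε * x * x ^ 19 := by rw [← hk]; ring
    rw [this]
    gcongr
  have h17 : 10 ^ 8 * x ^ 17 ≤ x ^ 19 := by
    have : x ^ 19 = x ^ 2 * x ^ 17 := by ring
    rw [this]
    gcongr
    nlinarith
  have h2 : x ^ 2 ≤ x ^ 17 := pow_le_pow_right₀ (by linarith) (by norm_num)
  have h3 : 1 ≤ x ^ 2 := one_le_pow₀ (by linarith)
  calc _ ≤ Real.exp (progress k M B - progress k M (T ^ 2)) * Real.exp (-(ε * k / 10)) := by
        gcongr
    _ ≤ _ := by
        rw [← Real.exp_add, Real.exp_le_exp]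
        linarith

theorem tail_bound {x ε k M B T : ℝ} {l : ℕ} (hx : 10 ^ 4 ≤ x)
    (hε : 0 < ε) (hε1 : ε ≤ 1) (hεx : 10 ^ 4 ≤ ε * x) (hk : x ^ 20 = k) (hM : x ^ 5 / 2 ≤ M)
    (hM' : M ≤ x ^ 5) (hB : B = 10 ^ 30 / ε ^ 3) (hT : T = k ^ 3 * Real.exp (x ^ 2))
    (hl : ε * k / 2 ≤ l) (hlk : l ≤ k) :
    Real.exp (progress k M B - progress k M (T ^ 2)) * (4 / 5) ^ l +
      l * (k * (20 / T) + M * (2 * Real.exp (-(40 * k / M)))) ≤ Real.exp (-x ^ 2) := by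
  have hx0 : 0 < x := by linarith
  have hk0 : 0 < k := by rw [← hk]; positivity
  have hM0 : 0 < M := lt_of_lt_of_le (by positivity) hM
  have hMk : M ≤ k := hM'.trans (by rw [← hk]; exact pow_le_pow_right₀ (by linarith) (by norm_num))
  have hk60 : 60 ≤ k := by
    have : x ^ 1 ≤ x ^ 20 := pow_le_pow_right₀ (by linarith) (by norm_num)
    linarith
  have h1 := exp_progress_mul_pow_le hx hε hε1 hεx hk hM hB hT hl
  have h2 : Real.exp (-x ^ 2 - 2) ≤ Real.exp (-x ^ 2) / 3 := by
    rw [Real.exp_sub]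
    have := Real.add_one_le_exp (2 : ℝ)
    gcongr
    linarith
  have h3 : l * (k * (20 / T)) ≤ Real.exp (-x ^ 2) / 3 := by
    calc l * (k * (20 / T)) ≤ k * (k * (20 / T)) := by
          have : 0 < T := by rw [hT]; positivity
          gcongr
      _ = 20 / k * Real.exp (-x ^ 2) := by
          rw [hT, Real.exp_neg]
          field_simp
      _ ≤ 1 / 3 * Real.exp (-x ^ 2) := by
          refine mul_le_mul_of_nonneg_right ?_ (Real.exp_pos _).le
          rw [div_le_div_iff₀ hk0 (by norm_num)]
          linarith
      _ = _ := by ring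
  have h4 : l * (M * (2 * Real.exp (-(40 * k / M)))) ≤ Real.exp (-x ^ 2) / 3 := by
    have h5 : x ^ 15 ≤ k / M := by
      rw [le_div_iff₀ hM0, ← hk]
      calc x ^ 15 * M ≤ x ^ 15 * x ^ 5 := by gcongr
        _ = _ := by ring
    have h6 : Real.exp (-(40 * k / M)) ≤ Real.exp (-(40 * x ^ 15)) := by
      rw [Real.exp_le_exp, mul_div_assoc]
      linarith
    have h7 : k ≤ Real.exp (20 * x) := by
      have h8 : x ≤ Real.exp x := by linarith [Real.add_one_le_exp x]
      calc k = x ^ 20 := hk.symm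
        _ ≤ Real.exp x ^ 20 := by gcongr
        _ = _ := by rw [← Real.exp_nat_mul]; norm_num
    have h9 : (6 : ℝ) ≤ Real.exp 5 := by linarith [Real.add_one_le_exp (5 : ℝ)]
    have h10 : x ^ 2 ≤ x ^ 15 := pow_le_pow_right₀ (by linarith) (by norm_num)
    calc l * (M * (2 * Real.exp (-(40 * k / M))))
        ≤ Real.exp (20 * x) * (Real.exp (20 * x) * (2 * Real.exp (-(40 * x ^ 15)))) := by
          gcongr
          · exact hlk.trans h7
          · exact hMk.trans h7
      _ = 6 * (Real.exp (20 * x) * (Real.exp (20 * x) * Real.exp (-(40 * x ^ 15)))) / 3 := by ring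
      _ ≤ Real.exp 5 * (Real.exp (20 * x) * (Real.exp (20 * x) * Real.exp (-(40 * x ^ 15)))) / 3 := by
          gcongr
      _ ≤ _ := by
          rw [← Real.exp_add, ← Real.exp_add, ← Real.exp_add]
          gcongr
          nlinarith
  rw [mul_add]
  linarith

theorem expect_cost_gt_le_exp {P : Finset (Pt d)} (hP : P.Nonempty)
    {pick : Finset (Pt d) → Pt d → Pt d} (hpick : IsArgminRule P pick) {F : Finset (Pt d)}
    (hF : F.Nonempty) {ε : ℝ} (hε : 0 < ε) (hε1 : ε ≤ 1) {k : ℕ} (hFk : F.card ≤ k)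
    (hk : 10 ^ 80 / ε ^ 20 ≤ (k : ℝ)) {l : ℕ} (hl : l = ⌊ε * (k : ℝ)⌋₊ ∨ l = ⌈ε * (k : ℝ)⌉₊) :
    expect (seedingThenLocalSearch P hP pick k l)
      (fun C => if 10 ^ 30 / ε ^ 3 * cost P F < cost P C then 1 else 0) ≤
      ENNReal.ofReal (Real.exp (-(k : ℝ) ^ (0.1 : ℝ))) := by
  set x : ℝ := (k : ℝ) ^ (1 / 20 : ℝ) with hx
  have hk0 : (0 : ℝ) < k := lt_of_lt_of_le (by positivity) hk
  have hx0 : 0 < x := by positivity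
  have hxk : x ^ 20 = k := by
    rw [hx, ← Real.rpow_natCast, ← Real.rpow_mul hk0.le]
    norm_num
  have hx2 : (k : ℝ) ^ (0.1 : ℝ) = x ^ 2 := by
    rw [hx, ← Real.rpow_natCast, ← Real.rpow_mul hk0.le]
    norm_num
  have hεx : 10 ^ 4 ≤ ε * x := by
    refine le_of_pow_le_pow_left₀ (n := 20) (by norm_num) (by positivity) ?_
    rw [div_le_iff₀ (by positivity), mul_comm] at hk
    rwa [mul_pow, hxk, ← pow_mul]
  have hx4 : 10 ^ 4 ≤ x := hεx.trans (by nlinarith)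
  have hkN : 1 ≤ k := by exact_mod_cast hk0
  have hkx : x ≤ k := by
    rw [← hxk]
    exact le_self_pow₀ (by linarith) (by norm_num)
  have hεk : 10 ^ 4 ≤ ε * k := hεx.trans (by gcongr)
  have hl1 : ε * k / 2 ≤ l := by
    rcases hl with rfl | rfl
    · linarith [Nat.lt_floor_add_one (ε * (k : ℝ))]
    · linarith [Nat.le_ceil (ε * (k : ℝ))]
  have hlk : l ≤ k := by
    have hle : ε * (k : ℝ) ≤ k := mul_le_of_le_one_left hk0.le hε1
    rcases hl with rfl | rfl
    · exact Nat.floor_le_of_le hle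
    · exact Nat.ceil_le.2 hle
  -- The factor `k ^ 3` pays for the union bound over `l` steps and the `k` samples of seeding, and
  -- `exp (x ^ 2)` is the target probability. Still `log T` is only of order `x ^ 2`.
  set T : ℝ := (k : ℝ) ^ 3 * Real.exp (x ^ 2) with hT
  have hk3 : (10 : ℝ) ^ 4 ≤ k := hx4.trans hkx
  have hTk : (k : ℝ) ^ 3 ≤ T := le_mul_of_one_le_right (by positivity)
    (Real.one_le_exp (by positivity))
  have hT20 : 20 ≤ T := by
    have : (k : ℝ) ≤ k ^ 3 := le_self_pow₀ (by linarith) (by norm_num)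
    linarith
  -- Large enough that the logarithmic phase, of length about `k / M * x ^ 2`, is short compared
  -- with `ε * k`; small enough that `exp (-(40 * k / M))` is negligible.
  set M := ⌊x ^ 5⌋₊ with hM
  have hx5 : (10 : ℝ) ^ 4 ≤ x ^ 5 := hx4.trans (le_self_pow₀ (by linarith) (by norm_num))
  have hM1 : (M : ℝ) ≤ x ^ 5 := Nat.floor_le (by positivity)
  have hM2 : x ^ 5 / 2 ≤ M := by linarith [Nat.lt_floor_add_one (x ^ 5)]
  have hM3 : 1000 ≤ M := Nat.le_floor (by push_cast; linarith)
  have hMk : M ≤ k := by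
    have : (M : ℝ) ≤ k := hM1.trans
      (by rw [← hxk]; exact pow_le_pow_right₀ (by linarith) (by norm_num))
    exact_mod_cast this
  have hl' : (l : ℝ) ≤ k := by exact_mod_cast hlk
  have htail := tail_bound hx4 hε hε1 hεx hxk hM2 hM1 rfl hT hl1 hl'
  rw [hx2]
  -- If `cost P F = 0`, ratios make no sense, but the crude bound already forces cost zero.
  rcases (cost_nonneg P F).eq_or_lt with h0 | h0
  · have h := expect_cost_gt_le hP pick hF hT20 hkN hFk l
    rw [← h0, mul_zero] at h ⊢
    refine h.trans ?_
    rw [← ENNReal.ofReal_natCast, ← ENNReal.ofReal_mul hk0.le]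
    refine ENNReal.ofReal_le_ofReal (le_trans ?_ htail)
    have h1 : (1 : ℝ) ≤ l := by linarith
    have h2 : (k : ℝ) * (20 / T) ≤ l * (k * (20 / T)) :=
      le_mul_of_one_le_left (by positivity) h1
    have h3 : 0 ≤ (l : ℝ) * (M * (2 * Real.exp (-(40 * k / M)))) := by positivity
    have h4 : 0 ≤ Real.exp (progress k M (10 ^ 30 / ε ^ 3) - progress k M (T ^ 2)) *
      (4 / 5) ^ l := by positivity
    rw [mul_add]
    linarith
  · have hB : (10 : ℝ) ^ 8 ≤ 10 ^ 30 / ε ^ 3 := by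
      rw [le_div_iff₀ (by positivity)]
      have : ε ^ 3 ≤ 1 := pow_le_one₀ hε.le hε1
      linarith
    have hBT : 10 ^ 30 / ε ^ 3 ≤ T ^ 2 := by
      have h1 : (10 : ℝ) ^ 30 / ε ^ 3 ≤ 10 ^ 80 / ε ^ 20 := by
        gcongr ?_ / ?_
        · norm_num
        · exact pow_le_pow_of_le_one hε.le hε1 (by norm_num)
      have h2 : T ≤ T ^ 2 := le_self_pow₀ (by linarith) (by norm_num)
      have h3 : (k : ℝ) ≤ k ^ 3 := le_self_pow₀ (by linarith) (by norm_num)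
      linarith
    exact (expect_cost_gt_le_of_pos hP hpick hF h0 hFk hM3 hMk hB hBT hT20 hlk).trans
      (ENNReal.ofReal_le_ofReal htail)

/-! ### Passing from the optimum to a reference set -/

/-- A multiple of the optimal cost can be replaced by the same multiple of the cost of a suitable
set of centers, as far as centers in `P` are concerned. -/
theorem exists_centers_cost_le_iff {P : Finset (Pt d)} (hP : P.Nonempty) {k : ℕ} (hk : 1 ≤ k)
    {B : ℝ} (hB : 0 < B) :
    ∃ F : Finset (Pt d), F.Nonempty ∧ F.card ≤ k ∧
      ∀ C ⊆ P, B * optCost P k < cost P C → B * cost P F < cost P C := by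
  have hne : {x : ℝ | ∃ C : Finset (Pt d), C.Nonempty ∧ C.card ≤ k ∧ cost P C = x}.Nonempty := by
    obtain ⟨p, _⟩ := hP
    exact ⟨_, {p}, by simp, by simpa using hk, rfl⟩
  -- Only finitely many costs occur for `C ⊆ P`, so those above `B * optCost P k` stay away from it
  -- by a gap. A nearly optimal `F` fits into the gap, and the infimum need not be attained.
  obtain ⟨v, hv, hvP⟩ : ∃ v, B * optCost P k < v ∧
      ∀ C ⊆ P, B * optCost P k < cost P C → v ≤ cost P C := by
    set S := P.powerset.filter fun C => B * optCost P k < cost P C with hS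
    by_cases h : S.Nonempty
    · obtain ⟨C, hC, hmin⟩ := S.exists_min_image (cost P) h
      exact ⟨cost P C, (Finset.mem_filter.1 hC).2, fun C' hC' hlt =>
        hmin C' (Finset.mem_filter.2 ⟨Finset.mem_powerset.2 hC', hlt⟩)⟩
    · exact ⟨B * optCost P k + 1, lt_add_one _, fun C hC hlt =>
        absurd ⟨C, Finset.mem_filter.2 ⟨Finset.mem_powerset.2 hC, hlt⟩⟩ h⟩
  have hlt : optCost P k < v / B := by rwa [lt_div_iff₀ hB, mul_comm]
  obtain ⟨_, ⟨F, hF, hFk, rfl⟩, hFv⟩ := exists_lt_of_csInf_lt hne hlt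
  refine ⟨F, hF, hFk, fun C hC hC' => lt_of_lt_of_le ?_ (hvP C hC hC')⟩
  rwa [lt_div_iff₀ hB, mul_comm] at hFv

end KMeans

end

theorem theorem1 :
    ∃ K : ℝ, 0 < K ∧ ∃ c : ℝ, 0 < c ∧
      ∀ (d : ℕ) (P : Finset (KMeans.Pt d)) (hP : P.Nonempty)
        (pick : Finset (KMeans.Pt d) → KMeans.Pt d → KMeans.Pt d),
        KMeans.IsArgminRule P pick →
      ∀ (ε : ℝ), 0 < ε → ε ≤ 1 →
      ∀ (k : ℕ), K / ε ^ 20 ≤ (k : ℝ) →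
      ∀ (l : ℕ), (l = ⌊ε * (k : ℝ)⌋₊ ∨ l = ⌈ε * (k : ℝ)⌉₊) →
        ENNReal.ofReal (1 - Real.exp (-(c * (k : ℝ) ^ (0.1 : ℝ)))) ≤
          (KMeans.seedingThenLocalSearch P hP pick k l).toOuterMeasure
            {C | KMeans.cost P C ≤ (10 : ℝ) ^ 30 / ε ^ 3 * KMeans.optCost P k} := by
  classical
  -- This `K` amounts to `10 ^ 4 ≤ ε * k ^ (1/20)`, the form in which the size of `k` enters the
  -- estimates.
  refine ⟨10 ^ 80, by norm_num, 1, one_pos, ?_⟩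
  intro d P hP pick hpick ε hε hε1 k hk l hl
  have hkN : 1 ≤ k := by
    have : (0 : ℝ) < k := lt_of_lt_of_le (by positivity) hk
    exact_mod_cast this
  obtain ⟨F, hF, hFk, hFC⟩ := KMeans.exists_centers_cost_le_iff hP hkN
    (by positivity : 0 < (10 : ℝ) ^ 30 / ε ^ 3)
  have h1 := KMeans.expect_cost_gt_le_exp hP hpick hF hε hε1 hFk hk hl
  set s : Set (Finset (KMeans.Pt d)) :=
    {C | KMeans.cost P C ≤ (10 : ℝ) ^ 30 / ε ^ 3 * KMeans.optCost P k} with hs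
  have h2 := KMeans.toOuterMeasure_add_compl (KMeans.seedingThenLocalSearch P hP pick k l) s
  have h3 : (KMeans.expect (KMeans.seedingThenLocalSearch P hP pick k l)
      fun C => if C ∈ s then 0 else 1) ≤
      ENNReal.ofReal (Real.exp (-(1 * (k : ℝ) ^ (0.1 : ℝ)))) := by
    rw [one_mul]
    refine (KMeans.expect_mono fun C hC => ?_).trans h1
    by_cases h : C ∈ s
    · rw [if_pos h]
      exact zero_le
    · have hCP := (KMeans.reachable_of_mem_support hP hpick hkN l C hC).1
      rw [if_neg h, if_pos (hFC C hCP (not_le.1 h))]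
  rw [ENNReal.ofReal_sub _ (Real.exp_pos _).le, ENNReal.ofReal_one, tsub_le_iff_right, ← h2]
  gcongr
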